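/- Let $N$ be a natural number and let $c_1,\dots,c_N>0$. There is a $\delta>0$, depending only on $N$ and $c_1,\dots,c_N$, such that for every $C_0\ge 0$ there is a constant $C$, depending only on $N$, $c_1,\dots,c_N$ and $C_0$, for which the following holds. Let $\mathcal K=\{r\omega:\ \omega\in S^2,\ 0\le r\le\phi(\omega)\}\subset\mathbb R^3$, where $\phi$ is a smooth positive function on $S^2$, and let $T>0$. Write $\partial_0=\partial_t$ and $\partial_k=\partial_{x_k}$ for $k=1,2,3$. For $1\le I,J\le N$ and $0\le j,k\le 3$ let $\gamma^{IJ,jk}$ be real-valued locally Lipschitz functions on $[0,T]\times(\mathbb R^3\setminus\mathcal K)$ that satisfy the symmetry conditions $\gamma^{IJ,jk}=\gamma^{JI,jk}=\gamma^{IJ,kj}$ and the bounds $$\sum_{I,J=1}^N\sum_{j,k=0}^3\|\gamma^{IJ,jk}\|_{L^\infty([0,T]\times(\mathbb R^3\setminus\mathcal K))}\le\delta,\qquad \sum_{I,J=1}^N\sum_{i,j,k=0}^3\int_0^T\|\partial_i\gamma^{IJ,jk}(t,\cdot)\|_{L^\infty(\mathbb R^3\setminus\mathcal K)}\,dt\le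 C_0 .$$ Let $w=(w^1,\dots,w^N)$ be a function of class $C^2$ (up to the boundary) on $(-\infty,T]\times\overline{\mathbb R^3\setminus\mathcal K}$ with $w(t,x)=0$ for $t\le 0$, with $w(t,x)=0$ for $0\le t\le T$ and $x\in\partial\mathcal K$, and with $$(\partial_t^2-c_I^2\Delta)w^I+\sum_{J=1}^N\sum_{j,k=0}^3\gamma^{IJ,jk}\,\partial_j\partial_kw^J=F^I\quad\text{on }(0,T)\times(\mathbb R^3\setminus\mathcal K),\qquad 1\le I\le N .$$ Then, with $w'=(\partial_jw^I)_{0\le j\le 3,\ 1\le I\le N}$, $$\|w'(t,\cdot)\|_{L^2(\mathbb R^3\setminus\mathcal K)}\le C\int_0^t\|F(s,\cdot)\|_{L^2(\mathbb R^3\setminus\mathcal K)}\,ds,\qquad 0\le t\le T,$$ where both sides are elements of $[0,\infty]$; in particular the left-hand side is finite whenever the right-hand side is. -/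

import Mathlib

open MeasureTheory Set

open scoped ENNReal NNReal Manifold

noncomputable section

namespace DirichletWave

/-- Euclidean space of dimension three. -/
abbrev Space := EuclideanSpace ℝ (Fin 3)

/-- Space-time points `(t, x)`. The product carries Lebesgue measure `dt dx`. -/
abbrev Spacetime := ℝ × Space

instance factFinrankSpace : Fact (Module.finrank ℝ Space = 2 + 1) := ⟨by simp⟩

/-- `K` is a smooth obstacle, strictly star-shaped with respect to the origin: in polar coordinates
`x = r ω` it is the set `{0 ≤ r ≤ φ ω}` for some smooth positive function `φ` on the unit sphere. -/
def IsStarShapedObstacle (K : Set Space) : Prop :=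
  ∃ φ : Metric.sphere (0 : Space) 1 → ℝ,
    ContMDiff (𝓡 2) 𝓘(ℝ, ℝ) ((⊤ : ℕ∞) : WithTop ℕ∞) φ ∧ (∀ ω, 0 < φ ω) ∧
      K = {x | ∃ (r : ℝ) (ω : Metric.sphere (0 : Space) 1), 0 ≤ r ∧ r ≤ φ ω ∧ x = r • (ω : Space)}

/-- The closed space-time domain `(-∞, T] × closure (ℝ³ \ K)`. -/
def domain (T : ℝ) (K : Set Space) : Set Spacetime := Iic T ×ˢ closure Kᶜ

/-- The coordinate directions of space-time: `dir 0` is the time direction, and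
`dir 1`, `dir 2`, `dir 3` are the three spatial directions. -/
def dir : Fin 4 → Spacetime :=
  Fin.cons (1, 0) fun k : Fin 3 => (0, EuclideanSpace.single k 1)

/-- The partial derivative `∂_j f`, where `∂_0 = ∂_t`, of a function on the set `S`. At interior
points of `S` this is the ordinary partial derivative; at boundary points it is one-sided. -/
def pd (S : Set Spacetime) (j : Fin 4) (f : Spacetime → ℝ) (z : Spacetime) : ℝ :=
  fderivWithin ℝ f S z (dir j)

/-- The `I`-th component of `□_γ w`, that is
`(∂_t² - c_I² Δ) w^I + ∑_J ∑_{j,k} γ^{IJ,jk} ∂_j ∂_k w^J`. -/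
def perturbedBox {N : ℕ} (S : Set Spacetime) (c : Fin N → ℝ)
    (γ : Fin N → Fin N → Fin 4 → Fin 4 → Spacetime → ℝ) (w : Fin N → Spacetime → ℝ)
    (I : Fin N) (z : Spacetime) : ℝ :=
  (pd S 0 (pd S 0 (w I)) z - c I ^ 2 * ∑ k : Fin 3, pd S k.succ (pd S k.succ (w I)) z) +
    ∑ J, ∑ j, ∑ k, γ I J j k z * pd S j (pd S k (w J)) z

/-- The symmetry conditions `γ^{IJ,jk} = γ^{JI,jk} = γ^{IJ,kj}` on `[0,T] × (ℝ³ \ K)`. -/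
def IsSymmetric {N : ℕ} (T : ℝ) (K : Set Space)
    (γ : Fin N → Fin N → Fin 4 → Fin 4 → Spacetime → ℝ) : Prop :=
  ∀ I J j k, ∀ z ∈ Icc 0 T ×ˢ Kᶜ, γ I J j k z = γ J I j k z ∧ γ I J j k z = γ I J k j z

/-- `∑ ‖γ^{IJ,jk}‖_{L^∞([0,T] × (ℝ³ \ K))}`. -/
def supNorm {N : ℕ} (T : ℝ) (K : Set Space)
    (γ : Fin N → Fin N → Fin 4 → Fin 4 → Spacetime → ℝ) : ℝ≥0∞ :=
  ∑ I, ∑ J, ∑ j, ∑ k, eLpNorm (γ I J j k) ⊤ (volume.restrict (Icc 0 T ×ˢ Kᶜ))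

/-- `∑ ‖∂_i γ^{IJ,jk}‖_{L^1_t L^∞_x([0,T] × (ℝ³ \ K))}`. For a locally Lipschitz `γ^{IJ,jk}` the
derivatives exist almost everywhere. -/
def derivNorm {N : ℕ} (T : ℝ) (K : Set Space)
    (γ : Fin N → Fin N → Fin 4 → Fin 4 → Spacetime → ℝ) : ℝ≥0∞ :=
  ∑ I, ∑ J, ∑ i, ∑ j, ∑ k, ∫⁻ t in Icc 0 T,
    eLpNorm (fun x : Space => pd (domain T K) i (γ I J j k) (t, x)) ⊤ (volume.restrict Kᶜ)

/-- `w` is a solution, of class `C²` up to the boundary, of the Dirichlet-wave equation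
`□_γ w = F` outside `K`, with `w = 0` on `∂K` and `w = 0` for `t ≤ 0`. -/
structure IsDirichletSolution {N : ℕ} (T : ℝ) (K : Set Space) (c : Fin N → ℝ)
    (γ : Fin N → Fin N → Fin 4 → Fin 4 → Spacetime → ℝ) (w F : Fin N → Spacetime → ℝ) : Prop where
  contDiffOn : ∀ I, ContDiffOn ℝ 2 (w I) (domain T K)
  equation : ∀ I, ∀ t ∈ Ioo 0 T, ∀ x ∈ Kᶜ, perturbedBox (domain T K) c γ w I (t, x) = F I (t, x)
  boundary : ∀ I, ∀ t ∈ Icc 0 T, ∀ x ∈ frontier K, w I (t, x) = 0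
  initial : ∀ I, ∀ t ≤ 0, ∀ x ∈ Kᶜ, w I (t, x) = 0

/-- `‖w'(t, ·)‖_{L²(ℝ³ \ K)}`, where `w'` is the collection of all `∂_j w^I`, `0 ≤ j ≤ 3`, with its
Euclidean length. -/
def gradNorm {N : ℕ} (T : ℝ) (K : Set Space) (w : Fin N → Spacetime → ℝ) (t : ℝ) : ℝ≥0∞ :=
  eLpNorm (fun x : Space =>
      WithLp.toLp 2 (fun p : Fin N × Fin 4 => pd (domain T K) p.2 (w p.1) (t, x)))
    2 (volume.restrict Kᶜ)

/-- `‖F(s, ·)‖_{L²(ℝ³ \ K)}`. -/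
def sliceNorm {N : ℕ} (K : Set Space) (F : Fin N → Spacetime → ℝ) (s : ℝ) : ℝ≥0∞ :=
  eLpNorm (fun x : Space => WithLp.toLp 2 (fun I : Fin N => F I (s, x))) 2 (volume.restrict Kᶜ)

end DirichletWave

end

noncomputable section

namespace DirichletWave

open Filter Topology

/-! ### Calculus of locally Lipschitz functions and Rademacher's theorem. -/

section LocallyLipschitz

variable {X : Type*} [PseudoMetricSpace X] {S : Set X} {f g : X → ℝ}

/-! The proof is the energy method with multiplier ∂_t w. Write g for the symmetric matrix `coeff`
of □_γ, indexed by pairs (component, direction). The flux e_j = ∑ g^{(I,j)β} ∂_t w^I ∂_β w - ½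
δ_{j0} ∑ g^{αβ} ∂_α w ∂_β w has divergence ∂_t w · F plus terms quadratic in w' that carry a
derivative of γ (`sum_fluxDeriv`, `IsCoercive.sum_fluxDeriv_eq`). If lam ≤ min(1, c_I²) for all I
and ∑|γ| ≤ lam/6, then e_0 ≥ (lam/4)|w'|² (`le_flux_zero`).

Two boundary contributions must be controlled. At the obstacle, the Dirichlet condition forces ∂_t w
= 0 on ∂K, and every term of a spatial flux component contains a time derivative. No boundary
integral is formed: C² regularity up to the boundary gives |∂_t w| ≤ B dist(x, K) on bounded sets
(`exists_bound_pd`), and the flux is multiplied by a cutoff of slope at most n + 1 that is constant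
outside dist(x, K) ≤ 2/(n + 1). The resulting error is bounded uniformly in n and lives on a layer
whose volume tends to 0. At infinity, w' is not known to be square integrable, so the flux is also
multiplied by max(0, 1 - (|x| + Mt)/R); for large M the derivatives of this factor contribute with a
favourable sign (`sum_cutoff_flux_le`). The cut off flux is Lipschitz with bounded spatial support,
so its divergence integrates by Fubini and the one-dimensional fundamental theorem
(`integral_divergence`).

What remains is λ E(t) ≤ ∫ (√E ‖F‖ + 2 ‖∂γ‖_∞ E) ds for the localized energy E, which is finite a
priori, with λ the coercivity constant. The Gronwall lemma `sqrt_le_of_le_lintegral` bounds √E by a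
constant depending only on λ and the integral of ‖∂γ‖_∞, not on R, and R → ∞ by monotone convergence
concludes. -/

theorem locallyLipschitzOn_add (hf : LocallyLipschitzOn S f) (hg : LocallyLipschitzOn S g) :
    LocallyLipschitzOn S (fun x => f x + g x) := by
  intro x hx
  obtain ⟨Cf, t, ht, hft⟩ := hf hx
  obtain ⟨Cg, u, hu, hgu⟩ := hg hx
  exact ⟨Cf + Cg, t ∩ u, inter_mem ht hu,
    (hft.mono inter_subset_left).add (hgu.mono inter_subset_right)⟩

theorem locallyLipschitzOn_const (a : ℝ) : LocallyLipschitzOn S (fun _ => a) :=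
  fun _ _ => ⟨0, univ, univ_mem, (LipschitzWith.const a).lipschitzOnWith⟩

theorem locallyLipschitzOn_sum {ι : Type*} (s : Finset ι) {f : ι → X → ℝ}
    (hf : ∀ i ∈ s, LocallyLipschitzOn S (f i)) :
    LocallyLipschitzOn S (fun x => ∑ i ∈ s, f i x) := by
  classical
  induction s using Finset.induction_on with
  | empty => simpa using locallyLipschitzOn_const 0
  | insert a s ha ih =>
    simp only [Finset.sum_insert ha]
    exact locallyLipschitzOn_add (hf a (by simp)) (ih fun i hi => hf i (by simp [hi]))

theorem locallyLipschitzOn_mul (hf : LocallyLipschitzOn S f) (hg : LocallyLipschitzOn S g) :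
    LocallyLipschitzOn S (fun x => f x * g x) := by
  intro x hx
  obtain ⟨Cf, t, ht, hft⟩ := hf hx
  obtain ⟨Cg, u, hu, hgu⟩ := hg hx
  have hf1 : ∀ᶠ y in 𝓝[S] x, |f y| < |f x| + 1 :=
    (hf.continuousOn x hx).abs.eventually_lt_const (by linarith)
  have hg1 : ∀ᶠ y in 𝓝[S] x, |g y| < |g x| + 1 :=
    (hg.continuousOn x hx).abs.eventually_lt_const (by linarith)
  refine ⟨(⟨|f x| + 1, by positivity⟩ * Cg + ⟨|g x| + 1, by positivity⟩ * Cf : ℝ≥0),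
    t ∩ u ∩ {y | |f y| < |f x| + 1 ∧ |g y| < |g x| + 1},
    inter_mem (inter_mem ht hu) (hf1.and hg1), ?_⟩
  refine LipschitzOnWith.of_dist_le_mul fun y hy z hz => ?_
  have h1 := hft.dist_le_mul y hy.1.1 z hz.1.1
  have h2 := hgu.dist_le_mul y hy.1.2 z hz.1.2
  rw [Real.dist_eq] at *
  have h3 : f y * g y - f z * g z = f y * (g y - g z) + g z * (f y - f z) := by ring
  rw [h3]
  refine (abs_add_le _ _).trans ?_
  rw [abs_mul, abs_mul]
  have h4 : |f y| * |g y - g z| ≤ (|f x| + 1) * (Cg * dist y z) :=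
    mul_le_mul hy.2.1.le h2 (abs_nonneg _) (by positivity)
  have h5 : |g z| * |f y - f z| ≤ (|g x| + 1) * (Cf * dist y z) :=
    mul_le_mul hz.2.2.le h1 (abs_nonneg _) (by positivity)
  push_cast
  change _ ≤ ((|f x| + 1) * (Cg : ℝ) + (|g x| + 1) * (Cf : ℝ)) * dist y z
  linarith

/-- A bounded function which is Lipschitz on `A` and vanishes off a set `B` at positive distance
from the complement of `A` is Lipschitz. -/
theorem lipschitzOnWith_of_eq_zero_off {A B : Set X} {L : ℝ≥0} {M r : ℝ} (hr : 0 < r) (hM : 0 ≤ M)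
    (hf : LipschitzOnWith L f (A ∩ S)) (hfM : ∀ x ∈ B ∩ S, |f x| ≤ M)
    (hB : ∀ x ∈ S, x ∉ B → f x = 0) (hd : ∀ x ∈ B, ∀ y ∉ A, r ≤ dist x y) :
    LipschitzOnWith (L + ⟨M / r, by positivity⟩) f S := by
  -- If y ∈ A the Lipschitz bound on A applies. Otherwise f y = 0 and the distance is at least r, so
  -- the bound M is itself at most (M / r) times the distance.
  have key : ∀ x ∈ S, ∀ y ∈ S, x ∈ B → y ∉ B →
      |f x - f y| ≤ (L + M / r) * dist x y := by
    intro x hx y hy hxB hyB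
    have hLd : 0 ≤ (L : ℝ) * dist x y := by positivity
    have hMd : 0 ≤ M / r * dist x y := by positivity
    have hxA : x ∈ A := by
      by_contra h
      have := hd x hxB x h
      rw [dist_self] at this
      linarith
    by_cases hyA : y ∈ A
    · have := hf.dist_le_mul x ⟨hxA, hx⟩ y ⟨hyA, hy⟩
      rw [Real.dist_eq] at this
      linarith
    · have h1 := hd x hxB y hyA
      rw [hB y hy hyB, sub_zero]
      have : M ≤ M / r * dist x y := by
        rw [div_mul_eq_mul_div, le_div_iff₀ hr]
        exact mul_le_mul_of_nonneg_left h1 hM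
      linarith [hfM x ⟨hxB, hx⟩]
  refine LipschitzOnWith.of_dist_le_mul fun x hx y hy => ?_
  rw [Real.dist_eq]
  change _ ≤ ((L : ℝ) + M / r) * dist x y
  have hLd : 0 ≤ (L : ℝ) * dist x y := by positivity
  have hMd : 0 ≤ M / r * dist x y := by positivity
  have hBA : ∀ x ∈ B, x ∈ A := by
    intro x hxB
    by_contra h
    have := hd x hxB x h
    rw [dist_self] at this
    linarith
  by_cases hxB : x ∈ B <;> by_cases hyB : y ∈ B
  · have := hf.dist_le_mul x ⟨hBA x hxB, hx⟩ y ⟨hBA y hyB, hy⟩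
    rw [Real.dist_eq] at this
    linarith
  · exact key x hx y hy hxB hyB
  · rw [abs_sub_comm, dist_comm]
    exact key y hy x hx hyB hxB
  · rw [hB x hx hxB, hB y hy hyB]
    simp only [sub_self, abs_zero]
    positivity

end LocallyLipschitz

/-- Rademacher's theorem for locally Lipschitz functions on open sets. -/
theorem ae_differentiableAt_of_locallyLipschitzOn {E : Type*} [NormedAddCommGroup E]
    [NormedSpace ℝ E] [FiniteDimensional ℝ E] [MeasurableSpace E] [BorelSpace E]
    (μ : Measure E) [μ.IsAddHaarMeasure] {O : Set E} (hO : IsOpen O) {f : E → ℝ}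
    (hf : LocallyLipschitzOn O f) : ∀ᵐ x ∂μ, x ∈ O → DifferentiableAt ℝ f x := by
  have h0 : μ {x | x ∈ O ∧ ¬ DifferentiableAt ℝ f x} = 0 := by
    refine measure_null_of_locally_null _ fun x hx => ?_
    obtain ⟨C, t, ht, hft⟩ := hf hx.1
    obtain ⟨V, hV, hxV, hVt⟩ := mem_nhdsWithin.1 ht
    refine ⟨(V ∩ O) ∩ {x | x ∈ O ∧ ¬ DifferentiableAt ℝ f x}, ?_, ?_⟩
    · exact inter_mem (mem_nhdsWithin_of_mem_nhds ((hV.inter hO).mem_nhds ⟨hxV, hx.1⟩))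
        self_mem_nhdsWithin
    · have h1 : ∀ᵐ y ∂μ, y ∈ V ∩ O → DifferentiableWithinAt ℝ f (V ∩ O) y :=
        (hft.mono hVt).ae_differentiableWithinAt_of_mem
      refine measure_mono_null ?_ h1
      rintro y ⟨hy, hy'⟩ h
      exact hy'.2 ((h hy).differentiableAt ((hV.inter hO).mem_nhds hy))
  rw [ae_iff]
  simpa using h0

/-! ### The divergence theorem on a slab for Lipschitz fields with bounded spatial support. -/

section Divergence

variable {f : Spacetime → ℝ} {L : ℝ≥0} {R t : ℝ}

theorem lineDeriv_eq_zero_of_lt_norm (hR : ∀ t x, R ≤ ‖x‖ → f (t, x) = 0) (v : Spacetime)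
    {z : Spacetime} (hz : R < ‖z.2‖) : lineDeriv ℝ f z v = 0 := by
  have : f =ᶠ[𝓝 z] fun _ => 0 := by
    have : ∀ᶠ y : Spacetime in 𝓝 z, R < ‖y.2‖ :=
      continuous_snd.norm.continuousAt.eventually_const_lt hz
    filter_upwards [this] with y hy
    exact hR y.1 y.2 hy.le
  rw [this.lineDeriv_eq, lineDeriv, deriv_const]

/-- The derivative is bounded by the Lipschitz constant and vanishes for ‖x‖ > R, where the slab is
cut down to finite measure. -/
theorem integrable_lineDeriv_slab (hf : LipschitzWith L f) (hR : ∀ t x, R ≤ ‖x‖ → f (t, x) = 0)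
    (v : Spacetime) :
    Integrable (fun z => lineDeriv ℝ f z v) ((volume.restrict (Ioo 0 t)).prod volume) := by
  have h1 : IntegrableOn (fun z => lineDeriv ℝ f z v) (univ ×ˢ Metric.closedBall (0 : Space) R)
      ((volume.restrict (Ioo 0 t)).prod volume) := by
    have : IsFiniteMeasure (((volume.restrict (Ioo 0 t)).prod (volume : Measure Space)).restrict
        (univ ×ˢ Metric.closedBall (0 : Space) R)) := by
      have : IsFiniteMeasure ((volume : Measure Space).restrict (Metric.closedBall 0 R)) :=
        isFiniteMeasure_restrict.2 measure_closedBall_lt_top.ne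
      rw [← Measure.prod_restrict, Measure.restrict_univ]
      infer_instance
    refine Integrable.mono' (integrable_const (L * ‖v‖)) ?_ ?_
    · exact (measurable_lineDeriv hf.continuous).aestronglyMeasurable
    · exact ae_of_all _ fun z => norm_lineDeriv_le_of_lipschitz ℝ hf
  refine (integrableOn_iff_integrable_of_support_subset ?_).1 h1
  intro z hz
  by_contra hz'
  refine hz (lineDeriv_eq_zero_of_lt_norm hR v ?_)
  simpa using hz'

/-- By Fubini, for fixed x the function of time is Lipschitz, hence absolutely continuous, and the
fundamental theorem of calculus applies. -/
theorem integral_lineDeriv_time (hf : LipschitzWith L f) (hR : ∀ t x, R ≤ ‖x‖ → f (t, x) = 0)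
    (ht : 0 ≤ t) :
    ∫ z, lineDeriv ℝ f z ((1, 0) : Spacetime) ∂((volume.restrict (Ioo 0 t)).prod volume) =
      (∫ x, f (t, x)) - ∫ x, f (0, x) := by
  rw [integral_prod_symm _ (integrable_lineDeriv_slab hf hR _)]
  have hc : ∀ s : ℝ, Integrable (fun x : Space => f (s, x)) := by
    intro s
    have : Continuous fun x : Space => f (s, x) := hf.continuous.comp (by fun_prop)
    refine this.integrable_of_hasCompactSupport ?_
    refine HasCompactSupport.intro (isCompact_closedBall (0 : Space) R) fun x hx => hR s x ?_
    have : R < ‖x‖ := by simpa using hx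
    exact this.le
  refine Eq.trans ?_ (integral_sub (hc t) (hc 0))
  refine integral_congr_ae (ae_of_all _ fun x => ?_)
  have h1 : ∀ s : ℝ, lineDeriv ℝ f (s, x) ((1, 0) : Spacetime) = deriv (fun s => f (s, x)) s := by
    intro s
    rw [lineDeriv]
    have : (fun r : ℝ => f ((s, x) + r • ((1, 0) : Spacetime))) =
        fun r : ℝ => (fun s => f (s, x)) (s + r) := by
      ext r
      simp
    rw [this]
    simpa using deriv_comp_const_add (fun s => f (s, x)) s 0
  simp only [h1]
  have h2 : LipschitzWith L (fun s : ℝ => f (s, x)) := by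
    simpa using! hf.comp (LipschitzWith.prodMk_right x)
  have h3 := (h2.lipschitzOnWith (s := uIcc 0 t)).absolutelyContinuousOnInterval.integral_deriv_eq_sub
  rw [intervalIntegral.integral_of_le ht, integral_Ioc_eq_integral_Ioo] at h3
  exact h3

theorem integral_lineDeriv_space (hf : LipschitzWith L f) (hR : ∀ t x, R ≤ ‖x‖ → f (t, x) = 0)
    (e : Space) :
    ∫ z, lineDeriv ℝ f z ((0, e) : Spacetime) ∂((volume.restrict (Ioo 0 t)).prod volume) = 0 := by
  rw [integral_prod _ (integrable_lineDeriv_slab hf hR _)]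
  refine integral_eq_zero_of_ae (ae_of_all _ fun s => ?_)
  have h1 : ∀ x : Space, lineDeriv ℝ f (s, x) ((0, e) : Spacetime) =
      lineDeriv ℝ (fun x : Space => f (s, x)) x e := by
    intro x
    rw [lineDeriv, lineDeriv]
    congr 1
    ext r
    simp
  simp only [h1, Pi.zero_apply]
  have h2 : LipschitzWith L (fun x : Space => f (s, x)) := by
    simpa using! hf.comp (LipschitzWith.prodMk_left s)
  have h3 : HasCompactSupport (fun x : Space => f (s, x)) := by
    refine HasCompactSupport.intro (isCompact_closedBall (0 : Space) R) fun x hx => hR s x ?_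
    have : R < ‖x‖ := by simpa using hx
    exact this.le
  -- Integration by parts against the constant 1, whose derivative vanishes; the direction `-e`
  -- becomes `e` on the other factor.
  have h5 := LipschitzWith.integral_lineDeriv_mul_eq (μ := (volume : Measure Space))
    (LipschitzWith.const (1 : ℝ)) h2 h3 (-e)
  simpa [lineDeriv] using h5.symm

/-- The field is controlled only for times in [0, T]. Composing with the projection of time onto [0,
T] gives globally Lipschitz functions with the same derivatives in the open slab; then the time
component yields the boundary terms and each spatial component integrates to 0. -/
theorem integral_divergence {T : ℝ} (hT : 0 ≤ T) (ht : t ∈ Icc 0 T) {H : Fin 4 → Spacetime → ℝ}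
    (hL : ∀ j, LipschitzOnWith L (H j) (Icc 0 T ×ˢ univ))
    (hR : ∀ j, ∀ s ∈ Icc 0 T, ∀ x, R ≤ ‖x‖ → H j (s, x) = 0) :
    Integrable (fun z => ∑ j, lineDeriv ℝ (H j) z (dir j))
        ((volume.restrict (Ioo 0 t)).prod volume) ∧
      ∫ z, ∑ j, lineDeriv ℝ (H j) z (dir j) ∂((volume.restrict (Ioo 0 t)).prod volume) =
        (∫ x, H 0 (t, x)) - ∫ x, H 0 (0, x) := by
  set p : Spacetime → Spacetime := fun z => ((projIcc 0 T hT z.1 : ℝ), z.2) with hp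
  have hpL : LipschitzWith 1 p := by
    have h1 : LipschitzWith 1 fun z : Spacetime => (projIcc 0 T hT z.1 : ℝ) := by
      have := (LipschitzWith.subtype_val (Icc 0 T)).comp
        ((LipschitzWith.projIcc hT).comp (LipschitzWith.prod_fst (α := ℝ) (β := Space)))
      simpa using! this
    simpa using! h1.prodMk (LipschitzWith.prod_snd (α := ℝ) (β := Space))
  have hpm : ∀ z, p z ∈ Icc 0 T ×ˢ (univ : Set Space) := fun z => ⟨(projIcc 0 T hT z.1).2, mem_univ _⟩
  have hpe : ∀ s ∈ Icc 0 T, ∀ x, p (s, x) = (s, x) := by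
    intro s hs x
    simp [hp, projIcc_of_mem hT hs]
  have hfL : ∀ j, LipschitzWith L (fun z => H j (p z)) := by
    intro j
    have := (hL j).comp (hpL.lipschitzOnWith (s := univ)) (fun z _ => hpm z)
    rw [lipschitzOnWith_univ] at this
    simpa using! this
  have hfR : ∀ j t x, R ≤ ‖x‖ → H j (p (t, x)) = 0 := by
    intro j t x hx
    exact hR j _ (projIcc 0 T hT t).2 x hx
  have hae : ∀ᵐ z ∂((volume.restrict (Ioo 0 t)).prod (volume : Measure Space)),
      ∑ j, lineDeriv ℝ (fun z => H j (p z)) z (dir j) = ∑ j, lineDeriv ℝ (H j) z (dir j) := by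
    have h1 : (volume.restrict (Ioo 0 t)).prod (volume : Measure Space) =
        (volume : Measure Spacetime).restrict (Ioo 0 t ×ˢ univ) := by
      rw [Measure.volume_eq_prod, ← Measure.prod_restrict, Measure.restrict_univ]
    rw [h1]
    filter_upwards [ae_restrict_mem (measurableSet_Ioo.prod MeasurableSet.univ)] with z hz
    refine Finset.sum_congr rfl fun j _ => ?_
    refine Filter.EventuallyEq.lineDeriv_eq ?_
    filter_upwards [(isOpen_Ioo.prod isOpen_univ).mem_nhds hz] with y hy
    rw [← Prod.mk.eta (p := y), hpe y.1 ⟨hy.1.1.le, hy.1.2.le.trans ht.2⟩]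
  have hint := fun j => integrable_lineDeriv_slab (t := t) (hfL j) (hfR j) (dir j)
  refine ⟨(integrable_finsetSum _ fun j _ => hint j).congr hae, ?_⟩
  rw [← integral_congr_ae hae, integral_finsetSum _ fun j _ => hint j, Fin.sum_univ_succ]
  have h0 : ∫ z, lineDeriv ℝ (fun z => H 0 (p z)) z (dir 0)
      ∂((volume.restrict (Ioo 0 t)).prod (volume : Measure Space)) =
        (∫ x, H 0 (t, x)) - ∫ x, H 0 (0, x) := by
    have := integral_lineDeriv_time (hfL 0) (hfR 0) ht.1
    simp only [hpe t ht, hpe 0 ⟨le_rfl, hT⟩] at this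
    exact this
  rw [h0, Finset.sum_eq_zero, add_zero]
  intro k _
  exact integral_lineDeriv_space (hfL k.succ) (hfR k.succ) _

end Divergence

/-! ### A Gronwall lemma for square roots of energies. -/

/-- An absolutely continuous function is bounded on the interval, and exp is Lipschitz on bounded
sets. -/
theorem absolutelyContinuousOnInterval_exp {A : ℝ → ℝ} {a b : ℝ}
    (hA : AbsolutelyContinuousOnInterval A a b) :
    AbsolutelyContinuousOnInterval (fun t => Real.exp (A t)) a b := by
  obtain ⟨M, hM⟩ := hA.exists_bound
  obtain ⟨L, hL⟩ := (Real.contDiff_exp (n := 1)).contDiffOn.exists_lipschitzOnWith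
    (by decide) (convex_Icc (-M) M) isCompact_Icc
  rw [absolutelyContinuousOnInterval_iff] at hA ⊢
  intro ε hε
  obtain ⟨δ, hδ, h⟩ := hA (ε / (L + 1)) (by positivity)
  refine ⟨δ, hδ, fun E hE hEδ => ?_⟩
  have h1 := h E hE hEδ
  have hmem : ∀ x ∈ uIcc a b, A x ∈ Icc (-M) M := fun x hx => abs_le.1 (hM x hx)
  calc ∑ i ∈ Finset.range E.1, dist (Real.exp (A (E.2 i).1)) (Real.exp (A (E.2 i).2))
      ≤ ∑ i ∈ Finset.range E.1, L * dist (A (E.2 i).1) (A (E.2 i).2) := by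
        refine Finset.sum_le_sum fun i hi => ?_
        exact hL.dist_le_mul _ (hmem _ (hE.left i hi).left) _ (hmem _ (hE.left i hi).right)
    _ = L * ∑ i ∈ Finset.range E.1, dist (A (E.2 i).1) (A (E.2 i).2) := by rw [Finset.mul_sum]
    _ ≤ L * (ε / (L + 1)) := by gcongr
    _ < (L + 1) * (ε / (L + 1)) := by gcongr; linarith
    _ = ε := by field

/-- The integrand is κ⁻¹ times the a.e. derivative of exp(κ ∫ α). Since α is merely integrable, the
fundamental theorem is applied in its absolutely continuous form. -/
theorem lintegral_mul_exp_primitive_le {t₀ κ : ℝ} (hκ : 0 < κ) {α : ℝ → ℝ} (hα : ∀ s, 0 ≤ α s)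
    (hint : IntervalIntegrable α volume 0 t₀) {t : ℝ} (ht : t ∈ Icc 0 t₀) :
    ∫⁻ s in Ioc 0 t, ENNReal.ofReal (α s * Real.exp (κ * ∫ r in (0 : ℝ)..s, α r)) ≤
      ENNReal.ofReal ((Real.exp (κ * ∫ r in (0 : ℝ)..t, α r) - 1) / κ) := by
  have ht0 : 0 ≤ t₀ := ht.1.trans ht.2
  have hint' : IntervalIntegrable α volume 0 t :=
    hint.mono_set (by rw [uIcc_of_le ht.1, uIcc_of_le ht0]; exact Icc_subset_Icc_right ht.2)
  set A : ℝ → ℝ := fun s => ∫ r in (0 : ℝ)..s, α r with hA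
  have hAC : AbsolutelyContinuousOnInterval (fun s => κ * A s) 0 t :=
    (hint'.absolutelyContinuousOnInterval_intervalIntegral (by simp)).const_mul κ
  have hg := absolutelyContinuousOnInterval_exp hAC
  have hderiv : ∀ᵐ s, s ∈ Ioc 0 t →
      deriv (fun s => Real.exp (κ * A s)) s = κ * (α s * Real.exp (κ * A s)) := by
    filter_upwards [hint'.ae_hasDerivAt_integral] with s hs hst
    have h1 := hs (by rw [uIcc_of_le ht.1]; exact Ioc_subset_Icc_self hst) 0 (by simp)
    have h2 := (h1.const_mul κ).exp
    rw [h2.deriv]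
    ring
  have hi : IntegrableOn (fun s => α s * Real.exp (κ * A s)) (Ioc 0 t) := by
    have h1 : IntervalIntegrable (fun s => α s * Real.exp (κ * A s)) volume 0 t := by
      refine hint'.mul_continuousOn ?_
      have := hg.continuousOn
      exact this
    exact (intervalIntegrable_iff_integrableOn_Ioc_of_le ht.1).1 h1
  have h3 := hg.integral_deriv_eq_sub
  rw [intervalIntegral.integral_of_le ht.1,
    setIntegral_congr_ae measurableSet_Ioc hderiv, integral_const_mul] at h3
  rw [← ofReal_integral_eq_lintegral_ofReal hi
    (ae_of_all _ fun s => mul_nonneg (hα s) (Real.exp_pos _).le)]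
  refine ENNReal.ofReal_le_ofReal ?_
  have h0 : A 0 = 0 := by simp [hA]
  rw [h0, mul_zero, Real.exp_zero] at h3
  rw [le_div_iff₀ hκ, mul_comm]
  exact h3.le

/-- Gronwall's lemma for energy inequalities: if `y ≤ κ ∫ (√y f + a y)`, then `√y` is bounded by
the integral of `f`, with a constant depending on `κ` and the integral of `a` only. -/
theorem sqrt_le_of_le_lintegral {t₀ : ℝ} (ht₀ : 0 ≤ t₀) {a f y : ℝ → ℝ≥0∞} {κ A₀ : ℝ≥0}
    (hκ : 0 < κ) {Y : ℝ≥0∞} (hY : Y ≠ ⊤) (ha : AEMeasurable a (volume.restrict (Ioc 0 t₀)))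
    (hf : AEMeasurable f (volume.restrict (Ioc 0 t₀))) (haA : ∫⁻ s in Ioc 0 t₀, a s ≤ A₀)
    (hyY : ∀ t ∈ Icc 0 t₀, y t ≤ Y)
    (hy : ∀ t ∈ Icc 0 t₀,
      y t ≤ κ * ∫⁻ s in Ioc 0 t, (y s ^ (1 / 2 : ℝ) * f s + a s * y s)) :
    y t₀ ^ (1 / 2 : ℝ) ≤ ENNReal.ofReal (2 * κ * Real.exp (2 * κ * A₀)) * ∫⁻ s in Ioc 0 t₀, f s := by
  have hκ' : (0 : ℝ) < κ := hκ
  set F := ∫⁻ s in Ioc 0 t₀, f s with hF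
  by_cases hFtop : F = ⊤
  · rw [hFtop, ENNReal.mul_top]
    · exact le_top
    · rw [Ne, ENNReal.ofReal_eq_zero, not_le]
      positivity
  have hafin : ∫⁻ s in Ioc 0 t₀, a s ≠ ⊤ := (haA.trans_lt ENNReal.coe_lt_top).ne
  have halt : ∀ᵐ s ∂volume.restrict (Ioc 0 t₀), a s < ⊤ := ae_lt_top' ha hafin
  set α : ℝ → ℝ := fun s => (a s).toReal with hα
  have hα0 : ∀ s, 0 ≤ α s := fun s => ENNReal.toReal_nonneg
  have hαI : IntegrableOn α (Ioc 0 t₀) := integrable_toReal_of_lintegral_ne_top ha hafin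
  have hαi : IntervalIntegrable α volume 0 t₀ :=
    (intervalIntegrable_iff_integrableOn_Ioc_of_le ht₀).2 hαI
  set A : ℝ → ℝ := fun s => ∫ r in (0 : ℝ)..s, α r with hA
  have hA0 : ∀ s ∈ Icc 0 t₀, 0 ≤ A s := fun s hs =>
    intervalIntegral.integral_nonneg hs.1 fun r _ => hα0 r
  have hAle : ∀ s ∈ Icc 0 t₀, A s ≤ A₀ := by
    intro s hs
    have h1 : A s ≤ A t₀ := by
      refine intervalIntegral.integral_mono_interval le_rfl hs.1 hs.2 (ae_of_all _ hα0) hαi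
    refine h1.trans ?_
    rw [hA]
    simp only
    rw [intervalIntegral.integral_of_le ht₀, hα, integral_toReal ha halt]
    exact ENNReal.toReal_le_coe_of_le_coe haA
  -- The exponent 2κ in the weight of S, twice the natural rate, makes the term with a contribute at
  -- most S / 2, which can be absorbed. This gives S ≤ 2κ √m F; then m ≤ exp(2κA₀) S, and dividing
  -- by √m finishes. Finiteness of Y is what permits both the absorption and the division.
  set m : ℝ≥0∞ := ⨆ s ∈ Icc 0 t₀, y s with hm
  set S : ℝ≥0∞ := ⨆ s ∈ Icc 0 t₀, y s * ENNReal.ofReal (Real.exp (-(2 * κ * A s))) with hS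
  have hym : ∀ s ∈ Icc 0 t₀, y s ≤ m := fun s hs => le_iSup₂ (f := fun s _ => y s) s hs
  have hyS : ∀ s ∈ Icc 0 t₀, y s ≤ S * ENNReal.ofReal (Real.exp (2 * κ * A s)) := by
    intro s hs
    have h1 : y s * ENNReal.ofReal (Real.exp (-(2 * κ * A s))) ≤ S :=
      le_iSup₂ (f := fun s _ => y s * ENNReal.ofReal (Real.exp (-(2 * κ * A s)))) s hs
    calc y s = y s * ENNReal.ofReal (Real.exp (-(2 * κ * A s))) *
          ENNReal.ofReal (Real.exp (2 * κ * A s)) := by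
            rw [mul_assoc, ← ENNReal.ofReal_mul (Real.exp_pos _).le, ← Real.exp_add]
            simp
      _ ≤ _ := by gcongr
  have hmY : m ≤ Y := iSup₂_le hyY
  have hSY : S ≤ Y := by
    refine iSup₂_le fun s hs => ?_
    calc y s * ENNReal.ofReal (Real.exp (-(2 * κ * A s))) ≤ Y * 1 := by
          gcongr
          · exact hyY s hs
          · rw [ENNReal.ofReal_le_one, Real.exp_le_one_iff]
            have := hA0 s hs
            have : 0 ≤ 2 * κ * A s := by positivity
            linarith
      _ = Y := mul_one Y
  have hstep : ∀ t ∈ Icc 0 t₀, y t ≤ κ * (m ^ (1 / 2 : ℝ) * F) +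
      S * ENNReal.ofReal ((Real.exp (2 * κ * A t) - 1) / 2) := by
    intro t ht
    have hsub : Ioc 0 t ⊆ Ioc 0 t₀ := Ioc_subset_Ioc_right ht.2
    have hf' : AEMeasurable f (volume.restrict (Ioc 0 t)) := hf.mono_measure (Measure.restrict_mono hsub le_rfl)
    calc y t ≤ κ * ∫⁻ s in Ioc 0 t, (y s ^ (1 / 2 : ℝ) * f s + a s * y s) := hy t ht
      -- y is replaced by its suprema before the integral is split, so measurability of y plays no
      -- role.
      _ ≤ κ * ∫⁻ s in Ioc 0 t, (m ^ (1 / 2 : ℝ) * f s +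
            S * ENNReal.ofReal (α s * Real.exp (2 * κ * A s))) := by
          gcongr κ * ?_
          refine lintegral_mono_ae ?_
          filter_upwards [ae_restrict_mem measurableSet_Ioc,
            ae_restrict_of_ae_restrict_of_subset hsub halt] with s hs hs'
          have hs0 : s ∈ Icc 0 t₀ := ⟨hs.1.le, hs.2.trans ht.2⟩
          gcongr ?_ * _ + ?_
          · exact ENNReal.rpow_le_rpow (hym s hs0) (by norm_num)
          · calc a s * y s ≤ a s * (S * ENNReal.ofReal (Real.exp (2 * κ * A s))) := by
                  gcongr
                  exact hyS s hs0
              _ = S * ENNReal.ofReal (α s * Real.exp (2 * κ * A s)) := by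
                  rw [ENNReal.ofReal_mul (hα0 s), hα, ENNReal.ofReal_toReal hs'.ne]
                  ring
      _ = κ * (m ^ (1 / 2 : ℝ) * (∫⁻ s in Ioc 0 t, f s) +
            S * ∫⁻ s in Ioc 0 t, ENNReal.ofReal (α s * Real.exp (2 * κ * A s))) := by
          rw [lintegral_add_left' (hf'.const_mul _), lintegral_const_mul'' _ hf',
            lintegral_const_mul' _ _ (ne_top_of_le_ne_top hY hSY)]
      _ ≤ κ * (m ^ (1 / 2 : ℝ) * F +
            S * ENNReal.ofReal ((Real.exp (2 * κ * A t) - 1) / (2 * κ))) := by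
          gcongr
          · exact lintegral_mono_set hsub
          · exact lintegral_mul_exp_primitive_le (by positivity) hα0 hαi ht
      _ = _ := by
          rw [mul_add]
          congr 1
          have h2 : (κ : ℝ≥0∞) = ENNReal.ofReal κ := by simp
          rw [h2, mul_left_comm, ← ENNReal.ofReal_mul hκ'.le]
          congr 2
          field_simp
  have hSle : S ≤ κ * (m ^ (1 / 2 : ℝ) * F) + S / 2 := by
    refine iSup₂_le fun t ht => ?_
    have hAt := hA0 t ht
    have hpos : 0 ≤ 2 * κ * A t := by positivity
    calc y t * ENNReal.ofReal (Real.exp (-(2 * κ * A t)))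
        ≤ (κ * (m ^ (1 / 2 : ℝ) * F) + S * ENNReal.ofReal ((Real.exp (2 * κ * A t) - 1) / 2)) *
            ENNReal.ofReal (Real.exp (-(2 * κ * A t))) := by
          gcongr
          exact hstep t ht
      _ = κ * (m ^ (1 / 2 : ℝ) * F) * ENNReal.ofReal (Real.exp (-(2 * κ * A t))) +
            S * ENNReal.ofReal ((1 - Real.exp (-(2 * κ * A t))) / 2) := by
          rw [add_mul, mul_assoc S, ← ENNReal.ofReal_mul' (Real.exp_pos _).le]
          congr 3
          have : Real.exp (2 * κ * A t) * Real.exp (-(2 * κ * A t)) = 1 := by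
            rw [← Real.exp_add]; simp
          linear_combination (1 / 2 : ℝ) * this
      _ ≤ κ * (m ^ (1 / 2 : ℝ) * F) * 1 + S * ENNReal.ofReal (1 / 2) := by
          gcongr
          · rw [ENNReal.ofReal_le_one, Real.exp_le_one_iff]
            linarith
          · have := Real.exp_pos (-(2 * κ * A t))
            linarith
      _ = _ := by
          rw [mul_one, ENNReal.ofReal_div_of_pos two_pos, div_eq_mul_inv S]
          simp
  have hStop : S ≠ ⊤ := ne_top_of_le_ne_top hY hSY
  have hS2 : S ≤ 2 * (κ * (m ^ (1 / 2 : ℝ) * F)) := by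
    have h1 : S / 2 ≤ κ * (m ^ (1 / 2 : ℝ) * F) := by
      have h2 : S / 2 + S / 2 ≤ κ * (m ^ (1 / 2 : ℝ) * F) + S / 2 := by
        rwa [ENNReal.add_halves]
      exact (ENNReal.add_le_add_iff_right (ENNReal.div_ne_top hStop two_ne_zero)).1 h2
    calc S = S / 2 + S / 2 := (ENNReal.add_halves S).symm
      _ ≤ _ := by rw [two_mul]; gcongr
  have hmS : m ≤ S * ENNReal.ofReal (Real.exp (2 * κ * A₀)) := by
    refine iSup₂_le fun s hs => (hyS s hs).trans ?_
    have := hAle s hs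
    gcongr
  set C : ℝ≥0∞ := ENNReal.ofReal (2 * κ * Real.exp (2 * κ * A₀)) with hC
  have hmain : m ≤ m ^ (1 / 2 : ℝ) * (C * F) := by
    calc m ≤ 2 * (κ * (m ^ (1 / 2 : ℝ) * F)) * ENNReal.ofReal (Real.exp (2 * κ * A₀)) := by
          refine hmS.trans ?_
          gcongr
      _ = _ := by
          rw [hC, ENNReal.ofReal_mul (by positivity), ENNReal.ofReal_mul (by positivity)]
          simp only [ENNReal.ofReal_ofNat, ENNReal.ofReal_coe_nnreal]
          ring
  have hmtop : m ≠ ⊤ := ne_top_of_le_ne_top hY hmY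
  have hsq : m = m ^ (1 / 2 : ℝ) * m ^ (1 / 2 : ℝ) := by
    rw [← ENNReal.rpow_add_of_nonneg _ _ (by norm_num) (by norm_num)]
    norm_num
  have hfin : m ^ (1 / 2 : ℝ) ≤ C * F := by
    by_cases h0 : m ^ (1 / 2 : ℝ) = 0
    · rw [h0]; exact zero_le
    · have hT : m ^ (1 / 2 : ℝ) ≠ ⊤ := ENNReal.rpow_ne_top_of_nonneg (by norm_num) hmtop
      refine (ENNReal.mul_le_mul_iff_right h0 hT).1 ?_
      rw [← hsq]
      exact hmain
  exact (ENNReal.rpow_le_rpow (hym t₀ ⟨ht₀, le_rfl⟩) (by norm_num)).trans hfin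

/-! ### Pointwise algebra of the energy flux. -/

section Flux

variable {N : ℕ}

/-- The coefficients of `δ_{IJ} (∂_t² - c_I² Δ)`. -/
def boxCoeff (c : Fin N → ℝ) (α β : Fin N × Fin 4) : ℝ :=
  if α = β then (if α.2 = 0 then 1 else -(c α.1) ^ 2) else 0

/-- The `j`-th component of the energy flux with coefficients `g` and gradient `u`. -/
def flux (g : Fin N × Fin 4 → Fin N × Fin 4 → ℝ) (u : Fin N × Fin 4 → ℝ) (j : Fin 4) : ℝ :=
  (∑ I, ∑ β, g (I, j) β * u (I, 0) * u β) -
    if j = 0 then 1 / 2 * ∑ α, ∑ β, g α β * u α * u β else 0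

/-- The linearization of the flux. -/
def fluxDeriv (g g' : Fin N × Fin 4 → Fin N × Fin 4 → ℝ) (u u' : Fin N × Fin 4 → ℝ)
    (j : Fin 4) : ℝ :=
  (∑ I, ∑ β, ((g' (I, j) β * u (I, 0) + g (I, j) β * u' (I, 0)) * u β +
      g (I, j) β * u (I, 0) * u' β)) -
    if j = 0 then 1 / 2 * ∑ α, ∑ β, ((g' α β * u α + g α β * u' α) * u β + g α β * u α * u' β)
      else 0

/-- The part of the divergence of the flux which involves derivatives of the coefficients. -/
def coeffError (u : Fin N × Fin 4 → ℝ) (Dg : Fin 4 → Fin N × Fin 4 → Fin N × Fin 4 → ℝ) : ℝ :=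
  (∑ j, ∑ I, ∑ β, Dg j (I, j) β * u (I, 0) * u β) - 1 / 2 * ∑ α, ∑ β, Dg 0 α β * u α * u β

/-- The squared length of the gradient. -/
def sqLen (u : Fin N × Fin 4 → ℝ) : ℝ := ∑ α, u α ^ 2

theorem sqLen_nonneg (u : Fin N × Fin 4 → ℝ) : 0 ≤ sqLen u :=
  Finset.sum_nonneg fun _ _ => sq_nonneg _

theorem hasDerivAt_flux {g : Fin N × Fin 4 → Fin N × Fin 4 → ℝ → ℝ} {u : Fin N × Fin 4 → ℝ → ℝ}
    {g' : Fin N × Fin 4 → Fin N × Fin 4 → ℝ} {u' : Fin N × Fin 4 → ℝ} {s : ℝ}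
    (hg : ∀ α β, HasDerivAt (g α β) (g' α β) s) (hu : ∀ α, HasDerivAt (u α) (u' α) s)
    (j : Fin 4) :
    HasDerivAt (fun r => flux (fun α β => g α β r) (fun α => u α r) j)
      (fluxDeriv (fun α β => g α β s) g' (fun α => u α s) u' j) s := by
  have hterm : ∀ α κ β, HasDerivAt (fun r => g α β r * u κ r * u β r)
      ((g' α β * u κ s + g α β s * u' κ) * u β s + g α β s * u κ s * u' β) s :=
    fun α κ β => ((hg α β).mul (hu κ)).mul (hu β)
  refine HasDerivAt.sub ?_ ?_
  · exact HasDerivAt.fun_sum fun I _ => HasDerivAt.fun_sum fun β _ => hterm _ _ _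
  · split_ifs
    · exact (HasDerivAt.fun_sum fun α _ => HasDerivAt.fun_sum fun β _ => hterm _ _ _).const_mul _
    · exact hasDerivAt_const _ _

/-- Here `Du j β` stands for ∂_j of the gradient component β, so `hDu` says that ∂_j and ∂_t
commute. The terms in which a derivative falls on the multiplier `u (I, 0)` become ∑ g (∂_t u_α)
u_β. By symmetry of g, the time derivative of the quadratic density, halved, produces the same sum,
and the two cancel. -/
theorem sum_fluxDeriv {g : Fin N × Fin 4 → Fin N × Fin 4 → ℝ} {u : Fin N × Fin 4 → ℝ}
    {Dg : Fin 4 → Fin N × Fin 4 → Fin N × Fin 4 → ℝ} {Du : Fin 4 → Fin N × Fin 4 → ℝ}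
    (hg : ∀ α β, g α β = g β α) (hDu : ∀ j I, Du j (I, 0) = Du 0 (I, j)) :
    ∑ j, fluxDeriv g (Dg j) u (Du j) j =
      (∑ I, u (I, 0) * ∑ j, ∑ β, g (I, j) β * Du j β) + coeffError u Dg := by
  have h1 : ∑ j, fluxDeriv g (Dg j) u (Du j) j =
      (∑ j, ∑ I, ∑ β, ((Dg j (I, j) β * u (I, 0) + g (I, j) β * Du j (I, 0)) * u β +
        g (I, j) β * u (I, 0) * Du j β)) -
      1 / 2 * ∑ α, ∑ β, ((Dg 0 α β * u α + g α β * Du 0 α) * u β + g α β * u α * Du 0 β) := by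
    simp only [fluxDeriv, Finset.sum_sub_distrib]
    congr 1
    simp
  have h2 : ∑ j, ∑ I, ∑ β, ((Dg j (I, j) β * u (I, 0) + g (I, j) β * Du j (I, 0)) * u β +
        g (I, j) β * u (I, 0) * Du j β) =
      (∑ j, ∑ I, ∑ β, Dg j (I, j) β * u (I, 0) * u β) + (∑ α, ∑ β, g α β * Du 0 α * u β) +
        ∑ I, u (I, 0) * ∑ j, ∑ β, g (I, j) β * Du j β := by
    have h3 : ∑ α, ∑ β, g α β * Du 0 α * u β =
        ∑ j : Fin 4, ∑ I : Fin N, ∑ β, g (I, j) β * Du j (I, 0) * u β := by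
      rw [Fintype.sum_prod_type, Finset.sum_comm]
      simp only [hDu]
    have h4 : ∑ I, u (I, 0) * ∑ j, ∑ β, g (I, j) β * Du j β =
        ∑ j : Fin 4, ∑ I : Fin N, ∑ β, g (I, j) β * u (I, 0) * Du j β := by
      rw [Finset.sum_comm]
      refine Finset.sum_congr rfl fun I _ => ?_
      rw [Finset.mul_sum]
      refine Finset.sum_congr rfl fun j _ => ?_
      rw [Finset.mul_sum]
      exact Finset.sum_congr rfl fun β _ => by ring
    rw [h3, h4]
    simp only [← Finset.sum_add_distrib]
    refine Finset.sum_congr rfl fun j _ => Finset.sum_congr rfl fun I _ =>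
      Finset.sum_congr rfl fun β _ => by ring
  have h5 : ∑ α, ∑ β, ((Dg 0 α β * u α + g α β * Du 0 α) * u β + g α β * u α * Du 0 β) =
      (∑ α, ∑ β, Dg 0 α β * u α * u β) + 2 * ∑ α, ∑ β, g α β * Du 0 α * u β := by
    have h6 : ∑ α, ∑ β, g α β * u α * Du 0 β = ∑ α, ∑ β, g α β * Du 0 α * u β := by
      rw [Finset.sum_comm]
      refine Finset.sum_congr rfl fun α _ => Finset.sum_congr rfl fun β _ => ?_
      rw [hg β α]
      ring
    have h7 : ∑ α, ∑ β, ((Dg 0 α β * u α + g α β * Du 0 α) * u β + g α β * u α * Du 0 β) =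
        (∑ α, ∑ β, Dg 0 α β * u α * u β) + (∑ α, ∑ β, g α β * Du 0 α * u β) +
          ∑ α, ∑ β, g α β * u α * Du 0 β := by
      simp only [← Finset.sum_add_distrib]
      refine Finset.sum_congr rfl fun α _ => Finset.sum_congr rfl fun β _ => by ring
    rw [h7, h6]
    ring
  rw [h1, h2, h5, coeffError]
  ring

theorem abs_mul_le_sqLen (u : Fin N × Fin 4 → ℝ) (α β : Fin N × Fin 4) :
    |u α * u β| ≤ sqLen u := by
  have h : ∀ α, u α ^ 2 ≤ sqLen u := fun α =>
    Finset.single_le_sum (f := fun α => u α ^ 2) (fun _ _ => sq_nonneg _) (Finset.mem_univ α)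
  have h1 : |u α * u β| ≤ (u α ^ 2 + u β ^ 2) / 2 := by
    rw [abs_le]
    constructor <;> nlinarith [sq_nonneg (u α + u β), sq_nonneg (u α - u β)]
  linarith [h α, h β]

theorem abs_sum_quadratic_le {g : Fin N × Fin 4 → Fin N × Fin 4 → ℝ} {u : Fin N × Fin 4 → ℝ}
    {B : ℝ} (hB : ∀ α β, |u α * u β| ≤ B) :
    |∑ α, ∑ β, g α β * u α * u β| ≤ (∑ α, ∑ β, |g α β|) * B := by
  rw [Finset.sum_mul]
  refine (Finset.abs_sum_le_sum_abs _ _).trans (Finset.sum_le_sum fun α _ => ?_)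
  rw [Finset.sum_mul]
  refine (Finset.abs_sum_le_sum_abs _ _).trans (Finset.sum_le_sum fun β _ => ?_)
  rw [mul_assoc, abs_mul]
  exact mul_le_mul_of_nonneg_left (hB α β) (abs_nonneg _)

theorem abs_sum_time_le {g : Fin N × Fin 4 → Fin N × Fin 4 → ℝ} {u : Fin N × Fin 4 → ℝ}
    {B : ℝ} (hB : ∀ I β, |u (I, 0) * u β| ≤ B) (hB0 : 0 ≤ B) (j : Fin 4) :
    |∑ I, ∑ β, g (I, j) β * u (I, 0) * u β| ≤ (∑ α, ∑ β, |g α β|) * B := by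
  have h1 : ∑ I, ∑ β, |g (I, j) β| ≤ ∑ α, ∑ β, |g α β| := by
    rw [Fintype.sum_prod_type]
    refine Finset.sum_le_sum fun I _ => ?_
    exact Finset.single_le_sum (f := fun j => ∑ β, |g (I, j) β|)
      (fun _ _ => Finset.sum_nonneg fun _ _ => abs_nonneg _) (Finset.mem_univ j)
  refine le_trans ?_ (mul_le_mul_of_nonneg_right h1 hB0)
  rw [Finset.sum_mul]
  refine (Finset.abs_sum_le_sum_abs _ _).trans (Finset.sum_le_sum fun α _ => ?_)
  rw [Finset.sum_mul]
  refine (Finset.abs_sum_le_sum_abs _ _).trans (Finset.sum_le_sum fun β _ => ?_)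
  rw [mul_assoc, abs_mul]
  exact mul_le_mul_of_nonneg_left (hB α β) (abs_nonneg _)

/-- In the spatial components every term contains a time derivative `u (I, 0)`, so bounding only
these products suffices. The bound B is left free: it is `sqLen u` in general, and gains a factor
dist(x, K) near the obstacle. -/
theorem abs_flux_le {g : Fin N × Fin 4 → Fin N × Fin 4 → ℝ} {u : Fin N × Fin 4 → ℝ}
    {B : ℝ} (hB : ∀ I β, |u (I, 0) * u β| ≤ B) (hB0 : 0 ≤ B) (k : Fin 3) :
    |flux g u k.succ| ≤ (∑ α, ∑ β, |g α β|) * B := by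
  have := abs_sum_time_le (g := g) hB hB0 k.succ
  simpa [flux, Fin.succ_ne_zero] using this

theorem abs_coeffError_le (u : Fin N × Fin 4 → ℝ)
    (Dg : Fin 4 → Fin N × Fin 4 → Fin N × Fin 4 → ℝ) :
    |coeffError u Dg| ≤ 2 * (∑ j, ∑ α, ∑ β, |Dg j α β|) * sqLen u := by
  have h1 : |∑ j, ∑ I, ∑ β, Dg j (I, j) β * u (I, 0) * u β| ≤
      (∑ j, ∑ α, ∑ β, |Dg j α β|) * sqLen u := by
    rw [Finset.sum_mul]
    refine (Finset.abs_sum_le_sum_abs _ _).trans (Finset.sum_le_sum fun j _ => ?_)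
    exact abs_sum_time_le (fun I β => abs_mul_le_sqLen u _ _) (sqLen_nonneg u) j
  have h2 : |∑ α, ∑ β, Dg 0 α β * u α * u β| ≤ (∑ j, ∑ α, ∑ β, |Dg j α β|) * sqLen u := by
    refine (abs_sum_quadratic_le (abs_mul_le_sqLen u)).trans
      (mul_le_mul_of_nonneg_right ?_ (sqLen_nonneg u))
    exact Finset.single_le_sum (f := fun j => ∑ α, ∑ β, |Dg j α β|)
      (fun _ _ => Finset.sum_nonneg fun _ _ => Finset.sum_nonneg fun _ _ => abs_nonneg _)
      (Finset.mem_univ (0 : Fin 4))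
  rw [coeffError]
  rw [abs_le] at *
  -- The two sums contribute 1 and 1/2; the constant 2 is a rounding up.
  constructor <;> linarith

theorem sum_abs_boxCoeff_add_le {c : Fin N → ℝ} {γ : Fin N × Fin 4 → Fin N × Fin 4 → ℝ} {δ : ℝ}
    (hγ : ∑ α, ∑ β, |γ α β| ≤ δ) :
    ∑ α, ∑ β, |boxCoeff c α β + γ α β| ≤ (∑ α, ∑ β, |boxCoeff c α β|) + δ := by
  refine le_trans ?_ (add_le_add_right hγ _)
  simp only [← Finset.sum_add_distrib]
  exact Finset.sum_le_sum fun α _ => Finset.sum_le_sum fun β _ => abs_add_le _ _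

/-- Subtracting half of the indefinite form halves the time part and flips the sign of the spatial
part, which leaves a positive density. -/
theorem flux_boxCoeff_zero (c : Fin N → ℝ) (u : Fin N × Fin 4 → ℝ) :
    flux (boxCoeff c) u 0 =
      1 / 2 * ∑ I, (u (I, 0) ^ 2 + ∑ k : Fin 3, c I ^ 2 * u (I, k.succ) ^ 2) := by
  have h1 : ∀ α κ, ∑ β, boxCoeff c α β * u κ * u β =
      (if α.2 = 0 then 1 else -(c α.1) ^ 2) * u κ * u α := by
    intro α κ
    rw [Finset.sum_eq_single α]
    · simp [boxCoeff]
    · intro β _ hβ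
      simp [boxCoeff, Ne.symm hβ]
    · simp
  simp only [flux, h1, if_true]
  rw [Fintype.sum_prod_type, Finset.mul_sum, Finset.mul_sum, ← Finset.sum_sub_distrib]
  refine Finset.sum_congr rfl fun I _ => ?_
  simp [Fin.sum_univ_succ, Fin.succ_ne_zero]
  ring

/-- The unperturbed density is at least (lam/2)|u|². The perturbation changes it by at most (1 +
1/2) δ |u|², and δ ≤ lam/6 makes this at most (lam/4)|u|². -/
theorem le_flux_zero {c : Fin N → ℝ} {γ : Fin N × Fin 4 → Fin N × Fin 4 → ℝ} {lam δ : ℝ}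
    (hlam : lam ≤ 1) (hc : ∀ I, lam ≤ c I ^ 2) (hδ : δ ≤ lam / 6)
    (hγ : ∑ α, ∑ β, |γ α β| ≤ δ) (u : Fin N × Fin 4 → ℝ) :
    lam / 4 * sqLen u ≤ flux (fun α β => boxCoeff c α β + γ α β) u 0 := by
  have h1 : flux (fun α β => boxCoeff c α β + γ α β) u 0 =
      flux (boxCoeff c) u 0 + flux γ u 0 := by
    simp only [flux, if_true, add_mul, Finset.sum_add_distrib]
    ring
  have h2 : lam / 2 * sqLen u ≤ flux (boxCoeff c) u 0 := by
    rw [flux_boxCoeff_zero, sqLen, Fintype.sum_prod_type, Finset.mul_sum, Finset.mul_sum]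
    refine Finset.sum_le_sum fun I _ => ?_
    rw [Fin.sum_univ_succ]
    have h3 : ∑ k : Fin 3, lam * u (I, k.succ) ^ 2 ≤ ∑ k : Fin 3, c I ^ 2 * u (I, k.succ) ^ 2 :=
      Finset.sum_le_sum fun k _ => mul_le_mul_of_nonneg_right (hc I) (sq_nonneg _)
    rw [← Finset.mul_sum] at h3
    nlinarith [mul_le_mul_of_nonneg_right hlam (sq_nonneg (u (I, 0)))]
  have h3 : |flux γ u 0| ≤ lam / 4 * sqLen u := by
    have hs := sqLen_nonneg u
    have h4 := abs_sum_time_le (g := γ) (fun I β => abs_mul_le_sqLen u (I, 0) β) hs 0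
    have h5 := abs_sum_quadratic_le (g := γ) (abs_mul_le_sqLen u)
    have h6 := mul_le_mul_of_nonneg_right (hγ.trans hδ) hs
    simp only [flux, if_true]
    rw [abs_le] at *
    constructor <;> linarith
  rw [h1]
  linarith [(abs_le.1 h3).1]

end Flux

/-! ### Topology of the obstacle. -/

/-- Substituting r = s φ(ω) exhibits K as the continuous image of the compact set [0, 1] × S². -/
theorem IsStarShapedObstacle.isClosed {K : Set Space} (hK : IsStarShapedObstacle K) :
    IsClosed K := by
  obtain ⟨φ, hφ, hpos, rfl⟩ := hK
  have hc : Continuous φ := hφ.continuous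
  have hcomp : IsCompact ((fun p : ℝ × Metric.sphere (0 : Space) 1 =>
      (p.1 * φ p.2) • (p.2 : Space)) '' (Icc 0 1 ×ˢ univ)) :=
    (isCompact_Icc.prod isCompact_univ).image (by fun_prop)
  convert! hcomp.isClosed using 1
  ext x
  constructor
  · rintro ⟨r, ω, h0, h1, rfl⟩
    refine ⟨(r / φ ω, ω), ⟨⟨div_nonneg h0 (hpos ω).le, (div_le_one (hpos ω)).2 h1⟩, mem_univ _⟩, ?_⟩
    simp only
    rw [div_mul_cancel₀ _ (hpos ω).ne']
  · rintro ⟨⟨s, ω⟩, ⟨hs, -⟩, rfl⟩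
    refine ⟨s * φ ω, ω, mul_nonneg hs.1 (hpos ω).le, ?_, rfl⟩
    exact mul_le_of_le_one_left (hpos ω).le hs.2

theorem IsStarShapedObstacle.nonempty {K : Set Space} (hK : IsStarShapedObstacle K) :
    K.Nonempty := by
  obtain ⟨φ, -, hpos, rfl⟩ := hK
  obtain ⟨ω, hω⟩ := NormedSpace.sphere_nonempty (E := Space) (x := 0) |>.2 zero_le_one
  exact ⟨0, 0, ⟨ω, hω⟩, le_rfl, (hpos _).le, by simp⟩

/-! ### Partial derivatives on the space-time domain and their behaviour at the obstacle. -/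

section Domain

variable {T : ℝ} {K : Set Space} {f : Spacetime → ℝ} {z : Spacetime}

/-- Near a point off K the closure in `domain` adds nothing, so `pd` is computed there in a product
with an open set, where derivatives are unique. -/
theorem domain_eventuallyEq (hK : IsClosed K) (hz : z.2 ∈ Kᶜ) :
    domain T K =ᶠ[𝓝 z] Iic T ×ˢ Kᶜ := by
  have h : ∀ᶠ y : Spacetime in 𝓝 z, y.2 ∈ Kᶜ :=
    continuous_snd.continuousAt.eventually (hK.isOpen_compl.mem_nhds hz)
  filter_upwards [h] with y hy
  refine propext ⟨fun h => ⟨h.1, hy⟩, fun h => ⟨h.1, subset_closure hy⟩⟩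

theorem uniqueDiffOn_Iic_prod (hK : IsClosed K) : UniqueDiffOn ℝ (Iic T ×ˢ Kᶜ : Set Spacetime) :=
  (uniqueDiffOn_Iic T).prod hK.isOpen_compl.uniqueDiffOn

theorem uniqueDiffWithinAt_domain (hK : IsClosed K) (hz : z ∈ Iic T ×ˢ Kᶜ) :
    UniqueDiffWithinAt ℝ (domain T K) z :=
  (uniqueDiffOn_Iic_prod hK z hz).mono fun _ hy => ⟨hy.1, subset_closure hy.2⟩

theorem domain_mem_nhds (hK : IsClosed K) (hz : z ∈ Iio T ×ˢ Kᶜ) : domain T K ∈ 𝓝 z :=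
  mem_of_superset ((isOpen_Iio.prod hK.isOpen_compl).mem_nhds hz) fun _ hy =>
    ⟨(mem_Iio.1 hy.1).le, subset_closure hy.2⟩

theorem pd_eq_fderiv (hK : IsClosed K) (hz : z ∈ Iio T ×ˢ Kᶜ) (j : Fin 4) :
    pd (domain T K) j f z = fderiv ℝ f z (dir j) := by
  rw [pd, fderivWithin_of_mem_nhds (domain_mem_nhds hK hz)]

theorem contDiffOn_pd (hK : IsClosed K) (hf : ContDiffOn ℝ 2 f (domain T K)) (j : Fin 4) :
    ContDiffOn ℝ 1 (pd (domain T K) j f) (Iic T ×ˢ Kᶜ) := by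
  have h1 : ContDiffOn ℝ 2 f (Iic T ×ˢ Kᶜ) :=
    hf.mono fun _ hy => ⟨hy.1, subset_closure hy.2⟩
  have h2 : ContDiffOn ℝ 1 (fderivWithin ℝ f (Iic T ×ˢ Kᶜ)) (Iic T ×ˢ Kᶜ) :=
    h1.fderivWithin (uniqueDiffOn_Iic_prod hK) (by norm_num)
  refine (h2.clm_apply (contDiffOn_const (c := dir j))).congr fun y hy => ?_
  rw [pd, fderivWithin_congr_set (domain_eventuallyEq hK hy.2)]

theorem pd_pd_eq (hK : IsClosed K) (hf : ContDiffOn ℝ 2 f (domain T K)) (hz : z ∈ Iio T ×ˢ Kᶜ)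
    (j k : Fin 4) :
    pd (domain T K) j (pd (domain T K) k f) z = fderiv ℝ (fderiv ℝ f) z (dir j) (dir k) := by
  have hc : ContDiffAt ℝ 2 f z := hf.contDiffAt (domain_mem_nhds hK hz)
  have hd : DifferentiableAt ℝ (fderiv ℝ f) z :=
    (hc.fderiv_right (m := 1) (by norm_num)).differentiableAt (by norm_num)
  have he : pd (domain T K) k f =ᶠ[𝓝 z] fun y => fderiv ℝ f y (dir k) := by
    filter_upwards [(isOpen_Iio.prod hK.isOpen_compl).mem_nhds hz] with y hy
    exact pd_eq_fderiv hK hy k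
  rw [pd_eq_fderiv hK hz, he.fderiv_eq, fderiv_clm_apply hd (differentiableAt_const _)]
  simp

theorem pd_comm (hK : IsClosed K) (hf : ContDiffOn ℝ 2 f (domain T K)) (hz : z ∈ Iio T ×ˢ Kᶜ)
    (j k : Fin 4) :
    pd (domain T K) j (pd (domain T K) k f) z = pd (domain T K) k (pd (domain T K) j f) z := by
  rw [pd_pd_eq hK hf hz, pd_pd_eq hK hf hz]
  have hc : ContDiffAt ℝ 2 f z := hf.contDiffAt (domain_mem_nhds hK hz)
  exact (hc.isSymmSndFDerivAt (by simp)).eq _ _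

/-- At t = 0 the derivative is already determined by the past, where f vanishes, because {t ≤ 0} ×
Kᶜ is a set of unique differentiability. -/
theorem pd_eq_zero_of_nonpos (hT : 0 < T) (hK : IsClosed K) (hf : ContDiffOn ℝ 2 f (domain T K))
    (h0 : ∀ t ≤ 0, ∀ x ∈ Kᶜ, f (t, x) = 0) {t : ℝ} (ht : t ≤ 0) {x : Space} (hx : x ∈ Kᶜ)
    (j : Fin 4) : pd (domain T K) j f (t, x) = 0 := by
  have hz : ((t, x) : Spacetime) ∈ Iio T ×ˢ Kᶜ := ⟨ht.trans_lt hT, hx⟩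
  have hz0 : ((t, x) : Spacetime) ∈ Iic 0 ×ˢ Kᶜ := ⟨ht, hx⟩
  rw [pd_eq_fderiv hK hz]
  have hd : HasFDerivAt f (fderiv ℝ f (t, x)) (t, x) :=
    ((hf.contDiffAt (domain_mem_nhds hK hz)).differentiableAt (by norm_num)).hasFDerivAt
  have h1 : HasFDerivWithinAt f (0 : Spacetime →L[ℝ] ℝ) (Iic 0 ×ˢ Kᶜ) (t, x) :=
    (hasFDerivWithinAt_const (0 : ℝ) _ _).congr (fun y hy => h0 y.1 hy.1 y.2 hy.2) (h0 t ht x hx)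
  rw [(uniqueDiffOn_Iic_prod hK _ hz0).eq hd.hasFDerivWithinAt h1]
  simp

theorem norm_dir (j : Fin 4) : ‖dir j‖ = 1 := by
  refine Fin.cases ?_ (fun k => ?_) j
  · simp [dir, Prod.norm_def]
  · simp [dir, Prod.norm_def]

/-- Since f vanishes on ∂K at all times in [0, T], so does ∂_t f; being C¹ up to the boundary, ∂_t f
is then O(dist). The domain need not be convex near ∂K, so the mean value inequality is used along
the segment from x to a nearest point p of K, which lies in the ball of radius dist(x, K) about x
and hence in the closure of Kᶜ. -/
theorem exists_local_bound_pd (hT : 0 < T) (hK : IsClosed K) (hKn : K.Nonempty)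
    (hf : ContDiffOn ℝ 2 f (domain T K))
    (hb : ∀ t ∈ Icc 0 T, ∀ x ∈ frontier K, f (t, x) = 0) (hz : z ∈ Icc 0 T ×ˢ closure Kᶜ) :
    ∃ V ∈ 𝓝 z, ∃ B : ℝ, ∀ y ∈ V, y ∈ Icc 0 T ×ˢ Kᶜ → (∀ j, |pd (domain T K) j f y| ≤ B) ∧
      |pd (domain T K) 0 f y| ≤ B * Metric.infDist y.2 K := by
  have hzD : z ∈ domain T K := ⟨hz.1.2, hz.2⟩
  have h2 : ContDiffWithinAt ℝ (1 + 1) f (domain T K) z := by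
    have := hf z hzD
    norm_num at this ⊢
    exact this
  -- `f'` and `f''` are some derivatives near z supplied by C² regularity. They also make sense on
  -- ∂K, where uniqueness of derivatives is not available; off K, `f'` agrees with `pd`.
  obtain ⟨u, hu, -, f', hf', hf'c⟩ := (contDiffWithinAt_succ_iff_hasFDerivWithinAt (by simp)).1 h2
  rw [insert_eq_of_mem hzD] at hu
  have hzu : z ∈ u := mem_of_mem_nhdsWithin hzD hu
  have h1 : ContDiffWithinAt ℝ (0 + 1) f' u z := by simpa using hf'c
  obtain ⟨u₂, hu₂, -, f'', hf'', hf''c⟩ := (contDiffWithinAt_succ_iff_hasFDerivWithinAt (by simp)).1 h1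
  rw [insert_eq_of_mem hzu] at hu₂
  have hzu₂ : z ∈ u₂ := mem_of_mem_nhdsWithin hzu hu₂
  have hu₂D : u₂ ∈ 𝓝[domain T K] z := nhdsWithin_le_iff.2 hu hu₂
  have hc1 : ∀ᶠ y in 𝓝[domain T K] z, ‖f' y‖ < ‖f' z‖ + 1 :=
    nhdsWithin_le_iff.2 hu (hf'c.continuousWithinAt.norm.eventually_lt_const (by linarith))
  have hc2 : ∀ᶠ y in 𝓝[domain T K] z, ‖f'' y‖ < ‖f'' z‖ + 1 :=
    nhdsWithin_le_iff.2 hu₂D (hf''c.continuousWithinAt.norm.eventually_lt_const (by linarith))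
  obtain ⟨ρ, hρ, hball⟩ := Metric.mem_nhdsWithin_iff.1 (inter_mem (inter_mem hu hu₂D) (hc1.and hc2))
  set W := Metric.ball z ρ ∩ domain T K with hW
  have hWf : ∀ y ∈ W, HasFDerivWithinAt f (f' y) W y := fun y hy =>
    (hf' y (hball hy).1.1).mono fun y hy => (hball hy).1.1
  have hWf' : ∀ y ∈ W, HasFDerivWithinAt f' (f'' y) W y := fun y hy =>
    (hf'' y (hball hy).1.2).mono fun y hy => (hball hy).1.2
  have hpd : ∀ y ∈ W, y.2 ∈ Kᶜ → ∀ j, pd (domain T K) j f y = f' y (dir j) := by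
    intro y hy hyK j
    have hd : HasFDerivWithinAt f (f' y) (domain T K) y := by
      have := hWf y hy
      rwa [hW, inter_comm, hasFDerivWithinAt_inter (Metric.isOpen_ball.mem_nhds hy.1)] at this
    rw [pd, hd.fderivWithin (uniqueDiffWithinAt_domain hK ⟨hy.2.1, hyK⟩)]
  have hbd : ∀ y ∈ W, ∀ j, |f' y (dir j)| ≤ ‖f' z‖ + 1 := by
    intro y hy j
    have := (f' y).le_opNorm (dir j)
    rw [norm_dir, mul_one, Real.norm_eq_abs] at this
    exact this.trans (hball hy).2.1.le
  have hsub : ∀ y ∈ Metric.ball z ρ, y ∈ Icc 0 T ×ˢ Kᶜ → y ∈ W := fun y hy hyS =>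
    ⟨hy, hyS.1.2, subset_closure hyS.2⟩
  by_cases hzK : z.2 ∈ K
  -- Half the radius keeps p in the ball of radius ρ, as dist(x, p) = dist(x, K) ≤ dist(x, z.2). The
  -- constant adds the bounds on `f'` and `f''` so that one number serves both claims.
  · refine ⟨Metric.ball z (ρ / 2), Metric.ball_mem_nhds z (by positivity),
      (‖f' z‖ + 1) + (‖f'' z‖ + 1), fun y hy hyS => ?_⟩
    have hyW : y ∈ W := hsub y (Metric.ball_subset_ball (by linarith) hy) hyS
    refine ⟨fun j => ?_, ?_⟩
    · rw [hpd y hyW hyS.2]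
      exact (hbd y hyW j).trans (by linarith [norm_nonneg (f'' z)])
    obtain ⟨t, x⟩ := y
    obtain ⟨ht, hx⟩ := hyS
    simp only at ht hx
    have htx : dist t z.1 < ρ / 2 ∧ dist x z.2 < ρ / 2 := by
      have h := hy
      rw [Metric.mem_ball, Prod.dist_eq, max_lt_iff] at h
      exact h
    obtain ⟨p, hpK, hp⟩ := hK.exists_infDist_eq_dist hKn x
    set r := Metric.infDist x K with hr
    have hrpos : 0 < r := (hK.notMem_iff_infDist_pos hKn).1 hx
    have hrle : r ≤ dist x z.2 := Metric.infDist_le_dist_of_mem hzK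
    have hbs : Metric.ball x r ⊆ Kᶜ := by
      intro q hq hqK
      have : r ≤ dist x q := Metric.infDist_le_dist_of_mem hqK
      rw [Metric.mem_ball, dist_comm] at hq
      linarith
    have hcbs : Metric.closedBall x r ⊆ closure Kᶜ := by
      rw [← closure_ball x hrpos.ne']
      exact closure_mono hbs
    set s : Set Spacetime := {t} ×ˢ (Metric.closedBall x r ∩ Metric.ball z.2 ρ) with hs
    have hsW : s ⊆ W := by
      rintro ⟨t', q⟩ ⟨ht', hq⟩
      rw [mem_singleton_iff] at ht'
      simp only at ht' hq
      subst ht'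
      refine ⟨?_, ht.2, hcbs hq.1⟩
      rw [Metric.mem_ball, Prod.dist_eq, max_lt_iff]
      exact ⟨by linarith [htx.1], hq.2⟩
    have hsc : Convex ℝ s :=
      (convex_singleton t).prod ((convex_closedBall x r).inter (convex_ball z.2 ρ))
    have hxs : ((t, x) : Spacetime) ∈ s :=
      ⟨rfl, Metric.mem_closedBall_self hrpos.le, by rw [Metric.mem_ball]; linarith [htx.2]⟩
    have hps : ((t, p) : Spacetime) ∈ s := by
      refine ⟨rfl, ?_, ?_⟩
      · rw [Metric.mem_closedBall, dist_comm]
        exact hp.symm.le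
      · rw [Metric.mem_ball]
        have := dist_triangle p x z.2
        rw [dist_comm p x, ← hp] at this
        linarith [htx.2]
    have hpf : p ∈ frontier K := by
      rw [frontier_eq_closure_inter_closure]
      exact ⟨subset_closure hpK, (hsW hps).2.2⟩
    -- The vertical segment through p stays in the domain, so this number is the derivative of s ↦ f
    -- (s, p) within [0, T], where one-dimensional uniqueness holds.
    have hp0 : f' (t, p) (dir 0) = 0 := by
      have hd := hWf _ (hsW hps)
      have hd' : HasFDerivWithinAt f (f' (t, p)) (domain T K) (t, p) := by
        rwa [hW, inter_comm, hasFDerivWithinAt_inter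
          (Metric.isOpen_ball.mem_nhds (hsW hps).1)] at hd
      have hline : HasDerivWithinAt (fun s : ℝ => ((s, p) : Spacetime)) (dir 0) (Icc 0 T) t := by
        have := ((hasDerivAt_id t).prodMk (hasDerivAt_const t p)).hasDerivWithinAt (s := Icc 0 T)
        exact this
      have hcomp : HasDerivWithinAt (fun s : ℝ => f (s, p)) (f' (t, p) (dir 0)) (Icc 0 T) t :=
        HasFDerivWithinAt.comp_hasDerivWithinAt (f := fun s : ℝ => ((s, p) : Spacetime)) t hd' hline
          (fun s hs => ⟨hs.2, (hsW hps).2.2⟩)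
      have hzero : HasDerivWithinAt (fun s : ℝ => f (s, p)) 0 (Icc 0 T) t :=
        (hasDerivWithinAt_const t (Icc 0 T) (0 : ℝ)).congr (fun s hs => hb s hs p hpf)
          (hb t ht p hpf)
      exact (uniqueDiffOn_Icc hT t ht).eq_deriv _ hcomp hzero
    have hmv := hsc.norm_image_sub_le_of_norm_hasFDerivWithin_le
      (fun y hy => (hWf' y (hsW hy)).mono hsW) (C := ‖f'' z‖ + 1)
      (fun y hy => (hball (hsW hy)).2.2.le) hps hxs
    have hn : ‖((t, x) : Spacetime) - (t, p)‖ = r := by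
      rw [hp, dist_eq_norm]
      simp [Prod.norm_def]
    rw [hn] at hmv
    rw [hpd _ hyW hx]
    have h3 : f' (t, x) (dir 0) = (f' (t, x) - f' (t, p)) (dir 0) := by
      simp [hp0]
    rw [h3]
    have h4 := (f' (t, x) - f' (t, p)).le_opNorm (dir 0)
    rw [norm_dir, mul_one, Real.norm_eq_abs] at h4
    refine h4.trans (hmv.trans ?_)
    have : 0 ≤ (‖f' z‖ + 1) * r := by positivity
    linarith
  -- Away from K the distance is at least d / 2 near z, so the gradient bound times 2 / d suffices.
  · have hd0 : 0 < Metric.infDist z.2 K := (hK.notMem_iff_infDist_pos hKn).1 hzK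
    set d := Metric.infDist z.2 K with hd
    have hev : ∀ᶠ y : Spacetime in 𝓝 z, d / 2 < Metric.infDist y.2 K :=
      ((Metric.continuous_infDist_pt K).comp continuous_snd).continuousAt.eventually_const_lt
        (by simp only [Function.comp]; linarith)
    refine ⟨Metric.ball z ρ ∩ {y | d / 2 < Metric.infDist y.2 K},
      inter_mem (Metric.ball_mem_nhds z hρ) hev,
      (‖f' z‖ + 1) + (‖f' z‖ + 1) * (2 / d), fun y hy hyS => ?_⟩
    have hyW := hsub y hy.1 hyS
    have hpos : 0 ≤ (‖f' z‖ + 1) * (2 / d) := by positivity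
    refine ⟨fun j => ?_, ?_⟩
    · rw [hpd y hyW hyS.2]
      exact (hbd y hyW j).trans (by linarith)
    · rw [hpd y hyW hyS.2]
      refine (hbd y hyW 0).trans ?_
      have hy2 : d / 2 < Metric.infDist y.2 K := hy.2
      have h5 : (‖f' z‖ + 1) * (2 / d) * (d / 2) = ‖f' z‖ + 1 := by field_simp
      have h6 : (‖f' z‖ + 1) * (2 / d) * (d / 2) ≤
          (‖f' z‖ + 1) * (2 / d) * Metric.infDist y.2 K := by gcongr
      have h7 : 0 ≤ (‖f' z‖ + 1) * Metric.infDist y.2 K := by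
        have := Metric.infDist_nonneg (x := y.2) (s := K)
        positivity
      linarith

/-- On bounded sets the gradient of a solution is bounded, and its time derivative is bounded by
the distance to the obstacle. -/
theorem exists_bound_pd (hT : 0 < T) (hK : IsClosed K) (hKn : K.Nonempty)
    (hf : ContDiffOn ℝ 2 f (domain T K))
    (hb : ∀ t ∈ Icc 0 T, ∀ x ∈ frontier K, f (t, x) = 0) (R : ℝ) :
    ∃ B : ℝ, ∀ t ∈ Icc 0 T, ∀ x ∈ Kᶜ, ‖x‖ ≤ R → (∀ j, |pd (domain T K) j f (t, x)| ≤ B) ∧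
      |pd (domain T K) 0 f (t, x)| ≤ B * Metric.infDist x K := by
  -- The closure makes the set compact; the local bounds hold near its boundary points too, although
  -- they are asserted only off K.
  have hcomp : IsCompact (Icc 0 T ×ˢ (closure Kᶜ ∩ Metric.closedBall (0 : Space) R)) :=
    isCompact_Icc.prod ((isCompact_closedBall _ _).inter_left isClosed_closure)
  have key : ∃ B : ℝ, ∀ y ∈ Icc 0 T ×ˢ (closure Kᶜ ∩ Metric.closedBall (0 : Space) R),
      y ∈ Icc 0 T ×ˢ Kᶜ → (∀ j, |pd (domain T K) j f y| ≤ B) ∧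
      |pd (domain T K) 0 f y| ≤ B * Metric.infDist y.2 K := by
    refine hcomp.induction_on (p := fun s => ∃ B : ℝ, ∀ y ∈ s,
      y ∈ Icc 0 T ×ˢ Kᶜ → (∀ j, |pd (domain T K) j f y| ≤ B) ∧
      |pd (domain T K) 0 f y| ≤ B * Metric.infDist y.2 K) ⟨0, by simp⟩ ?_ ?_ ?_
    · rintro s t hst ⟨B, hB⟩
      exact ⟨B, fun y hy => hB y (hst hy)⟩
    · rintro s t ⟨B, hB⟩ ⟨B', hB'⟩
      refine ⟨max B B', fun y hy hyS => ?_⟩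
      have hd := Metric.infDist_nonneg (x := y.2) (s := K)
      rcases hy with hy | hy
      · obtain ⟨h1, h2⟩ := hB y hy hyS
        exact ⟨fun j => (h1 j).trans (le_max_left _ _), h2.trans (by gcongr; exact le_max_left _ _)⟩
      · obtain ⟨h1, h2⟩ := hB' y hy hyS
        exact ⟨fun j => (h1 j).trans (le_max_right _ _),
          h2.trans (by gcongr; exact le_max_right _ _)⟩
    · intro y hy
      obtain ⟨V, hV, B, hB⟩ := exists_local_bound_pd hT hK hKn hf hb ⟨hy.1, hy.2.1⟩
      exact ⟨V, mem_nhdsWithin_of_mem_nhds hV, B, hB⟩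
  obtain ⟨B, hB⟩ := key
  exact ⟨B, fun t ht x hx hxR => hB (t, x) ⟨ht, subset_closure hx, by simpa using hxR⟩ ⟨ht, hx⟩⟩

end Domain

/-! ### Cutoffs near the obstacle and at infinity. -/

section Cutoffs

/-- A cutoff vanishing near `K`, equal to one at distance at least `2 / (n + 1)` from `K`. -/
def obstacleCutoff (K : Set Space) (n : ℕ) (z : Spacetime) : ℝ :=
  min 1 (max 0 ((n + 1) * Metric.infDist z.2 K - 1))

/-- A cutoff to the backward cone `|x| + M t < R`. -/
def coneCutoff (M R : ℝ) (z : Spacetime) : ℝ := max 0 (1 - (‖z.2‖ + M * z.1) / R)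

variable {K : Set Space} {n : ℕ} {M R : ℝ} {z : Spacetime}

theorem obstacleCutoff_nonneg : 0 ≤ obstacleCutoff K n z :=
  le_min zero_le_one (le_max_left _ _)

theorem obstacleCutoff_le_one : obstacleCutoff K n z ≤ 1 := min_le_left _ _

theorem lipschitzWith_obstacleCutoff : LipschitzWith (n + 1) (obstacleCutoff K n) := by
  have h1 : LipschitzWith 1 fun z : Spacetime => Metric.infDist z.2 K := by
    simpa using! (Metric.lipschitz_infDist_pt K).comp (LipschitzWith.prod_snd (α := ℝ) (β := Space))
  have h2 : LipschitzWith (n + 1) fun z : Spacetime => (n + 1 : ℝ) * Metric.infDist z.2 K - 1 := by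
    refine LipschitzWith.of_dist_le_mul fun x y => ?_
    have := h1.dist_le_mul x y
    rw [Real.dist_eq] at *
    rw [sub_sub_sub_cancel_right, ← mul_sub, abs_mul, abs_of_nonneg (by positivity : (0 : ℝ) ≤ n + 1)]
    push_cast at *
    rw [one_mul] at this
    gcongr
  exact (h2.const_max 0).const_min 1

theorem obstacleCutoff_eq_zero (h : (n + 1) * Metric.infDist z.2 K ≤ 1) :
    obstacleCutoff K n z = 0 := by
  rw [obstacleCutoff, max_eq_left (by linarith), min_eq_right zero_le_one]

theorem obstacleCutoff_eq_zero_of_mem (h : z.2 ∈ K) : obstacleCutoff K n z = 0 :=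
  obstacleCutoff_eq_zero (by rw [Metric.infDist_zero_of_mem h]; simp)

theorem obstacleCutoff_eq_one (h : 2 ≤ (n + 1) * Metric.infDist z.2 K) :
    obstacleCutoff K n z = 1 := by
  rw [obstacleCutoff, max_eq_right (by linarith), min_eq_left (by linarith)]

theorem obstacleCutoff_mono : Monotone fun n => obstacleCutoff K n z := by
  intro m n h
  have := Metric.infDist_nonneg (x := z.2) (s := K)
  have h' : (m : ℝ) ≤ n := by exact_mod_cast h
  simp only [obstacleCutoff]
  gcongr

theorem tendsto_obstacleCutoff (h : 0 < Metric.infDist z.2 K) :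
    Tendsto (fun n => obstacleCutoff K n z) atTop (𝓝 1) := by
  refine tendsto_const_nhds.congr' ?_
  obtain ⟨m, hm⟩ := exists_nat_ge (2 / Metric.infDist z.2 K)
  filter_upwards [eventually_ge_atTop m] with n hn
  refine (obstacleCutoff_eq_one ?_).symm
  rw [div_le_iff₀ h] at hm
  have h' : (m : ℝ) ≤ n := by exact_mod_cast hn
  nlinarith

theorem fderiv_obstacleCutoff_time (hd : DifferentiableAt ℝ (obstacleCutoff K n) z) :
    fderiv ℝ (obstacleCutoff K n) z (dir 0) = 0 := by
  rw [← hd.lineDeriv_eq_fderiv, lineDeriv]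
  have : (fun s : ℝ => obstacleCutoff K n (z + s • dir 0)) = fun _ => obstacleCutoff K n z := by
    ext s
    simp [obstacleCutoff, dir]
  rw [this, deriv_const]

theorem abs_fderiv_obstacleCutoff_le (j : Fin 4) :
    |fderiv ℝ (obstacleCutoff K n) z (dir j)| ≤ n + 1 := by
  have h1 := (fderiv ℝ (obstacleCutoff K n) z).le_opNorm (dir j)
  have h2 := norm_fderiv_le_of_lipschitz ℝ (x₀ := z) (lipschitzWith_obstacleCutoff (K := K) (n := n))
  rw [norm_dir, mul_one, Real.norm_eq_abs] at h1
  exact h1.trans (by simpa using h2)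

theorem fderiv_obstacleCutoff_eq_zero (h : 2 < (n + 1) * Metric.infDist z.2 K) :
    fderiv ℝ (obstacleCutoff K n) z = 0 := by
  have hc : Continuous fun y : Spacetime => (n + 1 : ℝ) * Metric.infDist y.2 K :=
    continuous_const.mul ((Metric.continuous_infDist_pt K).comp continuous_snd)
  have : obstacleCutoff K n =ᶠ[𝓝 z] fun _ => 1 := by
    filter_upwards [hc.continuousAt.eventually_const_lt h] with y hy
    exact obstacleCutoff_eq_one hy.le
  rw [this.fderiv_eq, fderiv_const_apply]

theorem coneCutoff_nonneg : 0 ≤ coneCutoff M R z := le_max_left _ _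

theorem coneCutoff_le_one (hM : 0 ≤ M) (hR : 0 < R) (hz : 0 ≤ z.1) : coneCutoff M R z ≤ 1 := by
  refine max_le zero_le_one ?_
  have : 0 ≤ (‖z.2‖ + M * z.1) / R := by positivity
  linarith

theorem coneCutoff_eq_zero (hM : 0 ≤ M) (hR : 0 < R) (hz : 0 ≤ z.1) (h : R ≤ ‖z.2‖) :
    coneCutoff M R z = 0 := by
  refine max_eq_left ?_
  have : 1 ≤ (‖z.2‖ + M * z.1) / R := by
    rw [le_div_iff₀ hR]
    nlinarith [mul_nonneg hM hz]
  linarith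

theorem coneCutoff_mono (hM : 0 ≤ M) (hz : 0 ≤ z.1) :
    Monotone fun n : ℕ => coneCutoff M (n + 1) z := by
  intro m n h
  have h' : (m : ℝ) ≤ n := by exact_mod_cast h
  simp only [coneCutoff]
  gcongr

theorem tendsto_coneCutoff : Tendsto (fun n : ℕ => coneCutoff M (n + 1) z) atTop (𝓝 1) := by
  have h1 : Tendsto (fun n : ℕ => (‖z.2‖ + M * z.1) / ((n : ℝ) + 1)) atTop (𝓝 0) :=
    tendsto_const_nhds.div_atTop (tendsto_natCast_atTop_atTop.atTop_add tendsto_const_nhds)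
  have h2 : Tendsto (fun n : ℕ => max 0 (1 - (‖z.2‖ + M * z.1) / ((n : ℝ) + 1))) atTop
      (𝓝 (max 0 (1 - 0))) := tendsto_const_nhds.max (tendsto_const_nhds.sub h1)
  simpa using! h2

theorem exists_lipschitzWith_coneCutoff : ∃ L, LipschitzWith L (coneCutoff M R) := by
  have h1 : LipschitzWith ‖M‖₊ fun z : Spacetime => M * z.1 := by
    simpa using! (lipschitzWith_smul M).comp (LipschitzWith.prod_fst (α := ℝ) (β := Space))
  have h2 : LipschitzWith 1 fun z : Spacetime => ‖z.2‖ := by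
    simpa using! lipschitzWith_one_norm.comp (LipschitzWith.prod_snd (α := ℝ) (β := Space))
  have h3 := (lipschitzWith_smul (R⁻¹)).comp (h2.add h1)
  have h4 := ((LipschitzWith.const (1 : ℝ)).sub h3).const_max 0
  have h5 : coneCutoff M R = fun x => max 0 (1 - ((fun x : ℝ => R⁻¹ • x) ∘
      fun x : Spacetime => ‖x.2‖ + M * x.1) x) := by
    ext x
    simp [coneCutoff, div_eq_inv_mul]
  rw [h5]
  exact ⟨_, h4⟩

theorem continuous_coneCutoff : Continuous (coneCutoff M R) := by
  unfold coneCutoff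
  fun_prop

theorem deriv_nonpos_of_le {g : ℝ → ℝ} {g' : ℝ} (hg : HasDerivAt g g' 0)
    (h : ∀ s, 0 < s → g s ≤ g 0) : g' ≤ 0 := by
  have h1 := hg.tendsto_slope_zero_right
  refine le_of_tendsto h1 ?_
  filter_upwards [self_mem_nhdsWithin] with s hs
  have hs' : 0 < s := hs
  have := h s hs'
  simp only [zero_add, smul_eq_mul]
  exact mul_nonpos_of_nonneg_of_nonpos (by positivity) (by linarith)

/-- Along (1, e) with ‖e‖ ≤ M the quantity ‖x‖ + M t does not decrease, by the triangle inequality,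
so the cutoff does not increase. -/
theorem fderiv_coneCutoff_add_le (hR : 0 < R)
    (hd : DifferentiableAt ℝ (coneCutoff M R) z) {e : Space} (he : ‖e‖ ≤ M) :
    fderiv ℝ (coneCutoff M R) z ((1, e) : Spacetime) ≤ 0 := by
  have h1 := hd.hasFDerivAt.hasLineDerivAt ((1, e) : Spacetime)
  refine deriv_nonpos_of_le h1 fun s hs => ?_
  simp only [zero_smul, add_zero, coneCutoff]
  have h2 : ‖z.2‖ ≤ ‖z.2 + s • e‖ + s * ‖e‖ := by
    have := norm_sub_le (z.2 + s • e) (s • e)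
    rwa [add_sub_cancel_right, norm_smul, Real.norm_of_nonneg hs.le] at this
  have h3 : s * ‖e‖ ≤ s * M := by gcongr
  have h4 : ‖z.2‖ + M * z.1 ≤ ‖z.2 + s • e‖ + M * (z.1 + s) := by nlinarith
  have h5 : (‖z.2‖ + M * z.1) / R ≤ (‖z.2 + s • e‖ + M * (z.1 + s)) / R := by gcongr
  simp only [Prod.snd_add, Prod.smul_snd, Prod.fst_add, Prod.smul_fst, smul_eq_mul, mul_one]
  exact max_le_max le_rfl (by linarith)

theorem fderiv_coneCutoff_time_nonpos (hR : 0 < R) (hM : 0 ≤ M)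
    (hd : DifferentiableAt ℝ (coneCutoff M R) z) :
    fderiv ℝ (coneCutoff M R) z (dir 0) ≤ 0 :=
  fderiv_coneCutoff_add_le hR hd (e := 0) (by simpa using hM)

/-- Take e = ±M times a unit vector. Thus the loss in time dominates M times the spatial variation,
which is finite propagation speed at the level of the cutoff. -/
theorem abs_fderiv_coneCutoff_le (hR : 0 < R) (hM : 0 ≤ M)
    (hd : DifferentiableAt ℝ (coneCutoff M R) z) (k : Fin 3) :
    M * |fderiv ℝ (coneCutoff M R) z (dir k.succ)| ≤ -fderiv ℝ (coneCutoff M R) z (dir 0) := by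
  have key : ∀ a : ℝ, |a| ≤ M → a * fderiv ℝ (coneCutoff M R) z (dir k.succ) ≤
      -fderiv ℝ (coneCutoff M R) z (dir 0) := by
    intro a ha
    have h1 := fderiv_coneCutoff_add_le hR hd (e := a • EuclideanSpace.single k 1)
      (by simpa [norm_smul] using ha)
    have h2 : ((1, a • EuclideanSpace.single k 1) : Spacetime) = dir 0 + a • dir k.succ := by
      simp [dir]
    rw [h2, map_add, map_smul, smul_eq_mul] at h1
    linarith
  rcases abs_choice (fderiv ℝ (coneCutoff M R) z (dir k.succ)) with h | h <;> rw [h]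
  · exact key M (abs_of_nonneg hM).le
  · have := key (-M) (by rw [abs_neg, abs_of_nonneg hM])
    linarith

end Cutoffs

/-- C¹ functions are Lipschitz near points of convex sets; U is shrunk to a ball to gain convexity.
-/
theorem ContDiffOn.locallyLipschitzOn_prod {f : Spacetime → ℝ} {T : ℝ} {U : Set Space}
    (hU : IsOpen U) (hf : ContDiffOn ℝ 1 f (Iic T ×ˢ U)) :
    LocallyLipschitzOn (Iic T ×ˢ U) f := by
  intro z hz
  obtain ⟨r, hr, hrU⟩ := Metric.isOpen_iff.1 hU z.2 hz.2
  have hsub : Iic T ×ˢ Metric.ball z.2 r ⊆ Iic T ×ˢ U := prod_mono le_rfl hrU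
  obtain ⟨C, t, ht, hft⟩ := (hf.mono hsub z ⟨hz.1, Metric.mem_ball_self hr⟩).exists_lipschitzOnWith
    ((convex_Iic T).prod (convex_ball z.2 r))
  refine ⟨C, t, ?_, hft⟩
  refine nhdsWithin_le_iff.2 ?_ ht
  have : (univ ×ˢ Metric.ball z.2 r : Set Spacetime) ∈ 𝓝 z :=
    (isOpen_univ.prod Metric.isOpen_ball).mem_nhds ⟨mem_univ _, Metric.mem_ball_self hr⟩
  filter_upwards [self_mem_nhdsWithin, mem_nhdsWithin_of_mem_nhds this] with y hy hy'
  exact ⟨hy.1, hy'.2⟩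

/-! ### The cut off energy flux and its divergence. -/

section Energy

variable {N : ℕ} {T : ℝ} {K : Set Space} {c : Fin N → ℝ}
  {γ : Fin N → Fin N → Fin 4 → Fin 4 → Spacetime → ℝ} {w F : Fin N → Spacetime → ℝ} {lam Γ : ℝ}

/-- The coefficients of `□_γ` as a matrix indexed by components of the gradient. -/
def coeff (c : Fin N → ℝ) (γ : Fin N → Fin N → Fin 4 → Fin 4 → Spacetime → ℝ)
    (α β : Fin N × Fin 4) (z : Spacetime) : ℝ :=
  boxCoeff c α β + γ α.1 β.1 α.2 β.2 z

/-- The components of the gradient of `w`. -/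
def grad (T : ℝ) (K : Set Space) (w : Fin N → Spacetime → ℝ) (α : Fin N × Fin 4)
    (z : Spacetime) : ℝ :=
  pd (domain T K) α.2 (w α.1) z

/-- The energy flux of `w` at a point of space-time. -/
def fluxAt (T : ℝ) (K : Set Space) (c : Fin N → ℝ)
    (γ : Fin N → Fin N → Fin 4 → Fin 4 → Spacetime → ℝ) (w : Fin N → Spacetime → ℝ)
    (j : Fin 4) (z : Spacetime) : ℝ :=
  flux (fun α β => coeff c γ α β z) (fun α => grad T K w α z) j

/-- The squared length of the gradient of `w` at a point of space-time. -/
def gradSq (T : ℝ) (K : Set Space) (w : Fin N → Spacetime → ℝ) (z : Spacetime) : ℝ :=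
  sqLen fun α => grad T K w α z

/-- The work done by the force `F`. -/
def work (T : ℝ) (K : Set Space) (w F : Fin N → Spacetime → ℝ) (z : Spacetime) : ℝ :=
  ∑ I, grad T K w (I, 0) z * F I z

/-- The sum of the absolute values of all first derivatives of the coefficients. -/
def derivSum (T : ℝ) (K : Set Space) (γ : Fin N → Fin N → Fin 4 → Fin 4 → Spacetime → ℝ)
    (z : Spacetime) : ℝ :=
  ∑ i, ∑ α : Fin N × Fin 4, ∑ β : Fin N × Fin 4,
    |pd (domain T K) i (γ α.1 β.1 α.2 β.2) z|

/-- A Dirichlet problem for which the energy is coercive with constant `lam`, and whose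
coefficients have sum at most `Γ`. -/
structure IsCoercive (T : ℝ) (K : Set Space) (c : Fin N → ℝ)
    (γ : Fin N → Fin N → Fin 4 → Fin 4 → Spacetime → ℝ) (w F : Fin N → Spacetime → ℝ)
    (lam Γ : ℝ) : Prop where
  pos : 0 < T
  isClosed : IsClosed K
  nonempty : K.Nonempty
  lipschitz : ∀ I J j k, LocallyLipschitzOn (Icc 0 T ×ˢ Kᶜ) (γ I J j k)
  symmetric : IsSymmetric T K γ
  solution : IsDirichletSolution T K c γ w F
  lam_pos : 0 < lam
  Γ_nonneg : 0 ≤ Γ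
  coercive : ∀ z ∈ Icc 0 T ×ˢ Kᶜ, ∀ u, lam * sqLen u ≤ flux (fun α β => coeff c γ α β z) u 0
  bounded : ∀ z ∈ Icc 0 T ×ˢ Kᶜ, ∑ α, ∑ β, |coeff c γ α β z| ≤ Γ

instance isAddHaarMeasure_spacetime : (volume : Measure Spacetime).IsAddHaarMeasure := by
  rw [Measure.volume_eq_prod]
  infer_instance

theorem gradSq_nonneg (z : Spacetime) : 0 ≤ gradSq T K w z := sqLen_nonneg _

theorem derivSum_nonneg (z : Spacetime) : 0 ≤ derivSum T K γ z :=
  Finset.sum_nonneg fun _ _ => Finset.sum_nonneg fun _ _ => Finset.sum_nonneg fun _ _ => abs_nonneg _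

/-- The energy flux, cut off near the obstacle and outside of a backward cone. -/
def cutFlux (T : ℝ) (K : Set Space) (c : Fin N → ℝ)
    (γ : Fin N → Fin N → Fin 4 → Fin 4 → Spacetime → ℝ) (w : Fin N → Spacetime → ℝ)
    (M R : ℝ) (n : ℕ) (j : Fin 4) (z : Spacetime) : ℝ :=
  obstacleCutoff K n z * coneCutoff M R z * fluxAt T K c γ w j z

/-- The part of the ball of radius `R` where the obstacle cutoff is not constant. -/
def layer (K : Set Space) (R : ℝ) (n : ℕ) : Set Space :=
  {x | x ∈ Kᶜ ∧ (n + 1) * Metric.infDist x K ≤ 2 ∧ ‖x‖ ≤ R}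

theorem locallyLipschitzOn_flux {X : Type*} [PseudoMetricSpace X] {S : Set X}
    {g : Fin N × Fin 4 → Fin N × Fin 4 → X → ℝ} {u : Fin N × Fin 4 → X → ℝ}
    (hg : ∀ α β, LocallyLipschitzOn S (g α β)) (hu : ∀ α, LocallyLipschitzOn S (u α))
    (j : Fin 4) :
    LocallyLipschitzOn S (fun x => flux (fun α β => g α β x) (fun α => u α x) j) := by
  have h1 : ∀ α κ β, LocallyLipschitzOn S (fun x => g α β x * u κ x * u β x) := fun α κ β =>
    locallyLipschitzOn_mul (locallyLipschitzOn_mul (hg α β) (hu κ)) (hu β)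
  by_cases hj : j = 0
  · have h2 := locallyLipschitzOn_add
      (locallyLipschitzOn_sum Finset.univ fun I _ =>
        locallyLipschitzOn_sum Finset.univ fun β _ => h1 (I, j) (I, 0) β)
      (locallyLipschitzOn_mul (locallyLipschitzOn_const (-(1 / 2)))
        (locallyLipschitzOn_sum Finset.univ fun α _ =>
          locallyLipschitzOn_sum Finset.univ fun β _ => h1 α α β))
    convert! h2 using 2 with x
    simp only [flux, if_pos hj]
    ring
  · have h2 := locallyLipschitzOn_sum Finset.univ fun I _ =>
        locallyLipschitzOn_sum Finset.univ fun β _ => h1 (I, j) (I, 0) β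
    convert! h2 using 2 with x
    simp only [flux, if_neg hj, sub_zero]

/-- With `Du` the derivatives of the gradient of w, the right-hand side is □_γ w, so the contraction
produced by `sum_fluxDeriv` can be replaced by F. -/
theorem sum_coeff_mul {I : Fin N} {z : Spacetime} (Du : Fin 4 → Fin N × Fin 4 → ℝ) :
    ∑ j, ∑ β, coeff c γ (I, j) β z * Du j β =
      (Du 0 (I, 0) - c I ^ 2 * ∑ k : Fin 3, Du k.succ (I, k.succ)) +
        ∑ J, ∑ j, ∑ k, γ I J j k z * Du j (J, k) := by
  simp only [coeff, add_mul, Finset.sum_add_distrib]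
  congr 1
  · have h1 : ∀ j, ∑ β, boxCoeff c (I, j) β * Du j β =
        (if j = 0 then 1 else -(c I) ^ 2) * Du j (I, j) := by
      intro j
      rw [Finset.sum_eq_single (I, j)]
      · simp [boxCoeff]
      · intro β _ hβ
        simp [boxCoeff, Ne.symm hβ]
      · simp
    simp only [h1]
    rw [Fin.sum_univ_succ]
    simp only [Fin.succ_ne_zero, if_true, if_false, Finset.mul_sum, one_mul, neg_mul,
      Finset.sum_neg_distrib]
    ring
  · simp only [Fintype.sum_prod_type]
    rw [Finset.sum_comm]

/-- Derivatives of η occur in three spatial directions only, each costing at most E. For χ,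
coercivity gives Dχ 0 * p 0 ≤ lam s Dχ 0, while the three spatial terms are together at most 3Γ s
|Dχ 0| / M; the condition 3Γ ≤ lam M makes the sum nonpositive. -/
theorem sum_cutoff_flux_le {η χ M lam Γ s E : ℝ} {Dη Dχ p : Fin 4 → ℝ} (hη : 0 ≤ η)
    (hη0 : Dη 0 = 0) (hχ : 0 ≤ χ) (hM : 0 < M) (hΓM : 3 * Γ ≤ lam * M) (hs : 0 ≤ s)
    (hχ0 : Dχ 0 ≤ 0) (hχk : ∀ k : Fin 3, M * |Dχ k.succ| ≤ -Dχ 0) (hp0 : lam * s ≤ p 0)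
    (hpk : ∀ k : Fin 3, |p k.succ| ≤ Γ * s)
    (hE : ∀ k : Fin 3, χ * (|Dη k.succ| * |p k.succ|) ≤ E) :
    ∑ j, (Dη j * χ + η * Dχ j) * p j ≤ 3 * E := by
  have h1 : ∑ j, (Dη j * χ + η * Dχ j) * p j = ∑ k : Fin 3, χ * (Dη k.succ * p k.succ) +
      η * (Dχ 0 * p 0 + ∑ k : Fin 3, Dχ k.succ * p k.succ) := by
    rw [Fin.sum_univ_succ, hη0, mul_add, Finset.mul_sum, add_left_comm, ← Finset.sum_add_distrib]
    congr 1
    · ring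
    · exact Finset.sum_congr rfl fun k _ => by ring
  have h2 : ∑ k : Fin 3, χ * (Dη k.succ * p k.succ) ≤ 3 * E := by
    have : ∑ k : Fin 3, χ * (Dη k.succ * p k.succ) ≤ ∑ _k : Fin 3, E := by
      refine Finset.sum_le_sum fun k _ => le_trans ?_ (hE k)
      rw [← abs_mul]
      gcongr
      exact le_abs_self _
    simpa using this
  have h3 : ∀ k : Fin 3, M * (Dχ k.succ * p k.succ) ≤ -Dχ 0 * (Γ * s) := by
    intro k
    calc M * (Dχ k.succ * p k.succ) ≤ M * (|Dχ k.succ| * |p k.succ|) := by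
          rw [← abs_mul]
          gcongr
          exact le_abs_self _
      _ = M * |Dχ k.succ| * |p k.succ| := by ring
      _ ≤ -Dχ 0 * (Γ * s) := by
          have := hpk k
          have := hχk k
          gcongr
          linarith
  have h4 : M * (Dχ 0 * p 0 + ∑ k : Fin 3, Dχ k.succ * p k.succ) ≤ 0 := by
    have h5 : M * ∑ k : Fin 3, Dχ k.succ * p k.succ ≤ ∑ _k : Fin 3, -Dχ 0 * (Γ * s) := by
      rw [Finset.mul_sum]
      exact Finset.sum_le_sum fun k _ => h3 k
    have h6 : ∑ _k : Fin 3, -Dχ 0 * (Γ * s) = -Dχ 0 * s * (3 * Γ) := by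
      simp
      ring
    have h7 : -Dχ 0 * s * (3 * Γ) ≤ -Dχ 0 * s * (lam * M) :=
      mul_le_mul_of_nonneg_left hΓM (mul_nonneg (by linarith) hs)
    have h8 : -Dχ 0 * M * (lam * s) ≤ -Dχ 0 * M * p 0 :=
      mul_le_mul_of_nonneg_left hp0 (mul_nonneg (by linarith) hM.le)
    rw [mul_add]
    nlinarith
  have h9 : Dχ 0 * p 0 + ∑ k : Fin 3, Dχ k.succ * p k.succ ≤ 0 := by
    by_contra hcon
    push Not at hcon
    linarith [mul_pos hM hcon]
  rw [h1]
  linarith [mul_nonpos_of_nonneg_of_nonpos hη h9]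

namespace IsCoercive

theorem locallyLipschitzOn_grad (h : IsCoercive T K c γ w F lam Γ) (α : Fin N × Fin 4) :
    LocallyLipschitzOn (Icc 0 T ×ˢ Kᶜ) (grad T K w α) :=
  (ContDiffOn.locallyLipschitzOn_prod h.isClosed.isOpen_compl
    (contDiffOn_pd h.isClosed (h.solution.contDiffOn α.1) α.2)).mono
    (prod_mono Icc_subset_Iic_self le_rfl)

theorem locallyLipschitzOn_coeff (h : IsCoercive T K c γ w F lam Γ) (α β : Fin N × Fin 4) :
    LocallyLipschitzOn (Icc 0 T ×ˢ Kᶜ) (coeff c γ α β) :=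
  locallyLipschitzOn_add (locallyLipschitzOn_const _) (h.lipschitz _ _ _ _)

theorem locallyLipschitzOn_fluxAt (h : IsCoercive T K c γ w F lam Γ) (j : Fin 4) :
    LocallyLipschitzOn (Icc 0 T ×ˢ Kᶜ) (fluxAt T K c γ w j) :=
  locallyLipschitzOn_flux h.locallyLipschitzOn_coeff h.locallyLipschitzOn_grad j

theorem locallyLipschitzOn_cutFlux (h : IsCoercive T K c γ w F lam Γ) (M R : ℝ) (n : ℕ)
    (j : Fin 4) : LocallyLipschitzOn (Icc 0 T ×ˢ Kᶜ) (cutFlux T K c γ w M R n j) := by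
  obtain ⟨L, hL⟩ := exists_lipschitzWith_coneCutoff (M := M) (R := R)
  exact locallyLipschitzOn_mul (locallyLipschitzOn_mul
    (lipschitzWith_obstacleCutoff.locallyLipschitz.locallyLipschitzOn)
    (hL.locallyLipschitz.locallyLipschitzOn)) (h.locallyLipschitzOn_fluxAt j)

theorem cutFlux_eq_zero {M R : ℝ} (hM : 0 ≤ M) (hR : 0 < R) {n : ℕ} {j : Fin 4} {z : Spacetime}
    (hz : 0 ≤ z.1) (h : (n + 1) * Metric.infDist z.2 K ≤ 1 ∨ R ≤ ‖z.2‖) :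
    cutFlux T K c γ w M R n j z = 0 := by
  rcases h with h | h
  · simp [cutFlux, obstacleCutoff_eq_zero h]
  · simp [cutFlux, coneCutoff_eq_zero hM hR hz h]

/-- The flux is locally Lipschitz only off K, but the cutoffs confine it to a set B well inside a
set A whose part in the slab is compact and off K. There local Lipschitz continuity is uniform, and
extension by zero preserves it. -/
theorem exists_lipschitzOnWith_cutFlux (h : IsCoercive T K c γ w F lam Γ) {M R : ℝ} (hM : 0 ≤ M)
    (hR : 0 < R) (n : ℕ) (j : Fin 4) :
    ∃ L, LipschitzOnWith L (cutFlux T K c γ w M R n j) (Icc 0 T ×ˢ univ) := by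
  -- A thickens B: half the distance to K and one unit more in radius. This gives the gap min 1 (1 /
  -- (2 (n + 1))) used below.
  set A : Set Spacetime := {z | 1 ≤ 2 * ((n + 1) * Metric.infDist z.2 K) ∧ ‖z.2‖ ≤ R + 1} with hA
  set B : Set Spacetime := {z | 1 ≤ (n + 1) * Metric.infDist z.2 K ∧ ‖z.2‖ ≤ R} with hB
  have hAS : A ∩ Icc 0 T ×ˢ univ =
      Icc 0 T ×ˢ ({x | 1 ≤ 2 * ((n + 1) * Metric.infDist x K)} ∩ Metric.closedBall (0 : Space) (R + 1)) := by
    ext z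
    simp [hA, and_comm]
  have hcomp : IsCompact (A ∩ Icc 0 T ×ˢ univ) := by
    rw [hAS]
    refine isCompact_Icc.prod ((isCompact_closedBall _ _).inter_left ?_)
    exact isClosed_le continuous_const
      (continuous_const.mul (continuous_const.mul (Metric.continuous_infDist_pt K)))
  have hsub : A ∩ Icc 0 T ×ˢ univ ⊆ Icc 0 T ×ˢ Kᶜ := by
    rintro z ⟨hz, hzT, -⟩
    refine ⟨hzT, fun hzK => ?_⟩
    have := hz.1
    rw [Metric.infDist_zero_of_mem hzK] at this
    norm_num at this
  have hl := (h.locallyLipschitzOn_cutFlux M R n j).mono hsub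
  obtain ⟨L, hL⟩ := hl.exists_lipschitzOnWith_of_compact hcomp
  obtain ⟨C, hC⟩ := hcomp.exists_bound_of_continuousOn hl.continuousOn
  have hBA : B ⊆ A := fun z hz => ⟨by linarith [hz.1], by linarith [hz.2]⟩
  refine ⟨_, lipschitzOnWith_of_eq_zero_off (A := A) (B := B) (M := max C 0)
    (r := min 1 (1 / (2 * (n + 1)))) (by positivity) (le_max_right _ _) hL ?_ ?_ ?_⟩
  · intro z hz
    exact (hC z ⟨hBA hz.1, hz.2⟩).trans (le_max_left _ _)
  · intro z hz hzB
    refine cutFlux_eq_zero hM hR hz.1.1 ?_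
    by_contra hcon
    push Not at hcon
    exact hzB ⟨hcon.1.le, hcon.2.le⟩
  · intro x hx y hy
    have hd : dist x.2 y.2 ≤ dist x y := le_max_right _ _
    rw [hA, mem_ofPred_eq, not_and_or, not_le, not_le] at hy
    rcases hy with hy | hy
    · refine (min_le_right _ _).trans (le_trans ?_ hd)
      have h1 : Metric.infDist x.2 K ≤ Metric.infDist y.2 K + dist x.2 y.2 :=
        Metric.infDist_le_infDist_add_dist
      have h2 := hx.1
      rw [div_le_iff₀ (by positivity)]
      nlinarith
    · refine (min_le_left _ _).trans (le_trans ?_ hd)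
      have h1 : ‖y.2‖ ≤ ‖x.2‖ + dist x.2 y.2 := by
        rw [dist_comm, dist_eq_norm]
        exact norm_le_norm_add_norm_sub' _ _
      linarith [hx.2]

theorem ae_differentiableAt (h : IsCoercive T K c γ w F lam Γ) (M R : ℝ) (n : ℕ) :
    ∀ᵐ z : Spacetime, z ∈ Ioo 0 T ×ˢ Kᶜ →
      (∀ α β : Fin N × Fin 4, DifferentiableAt ℝ (γ α.1 β.1 α.2 β.2) z) ∧
      DifferentiableAt ℝ (obstacleCutoff K n) z ∧ DifferentiableAt ℝ (coneCutoff M R) z := by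
  obtain ⟨L, hL⟩ := exists_lipschitzWith_coneCutoff (M := M) (R := R)
  have h1 : ∀ᵐ z : Spacetime, ∀ α β : Fin N × Fin 4, z ∈ Ioo 0 T ×ˢ Kᶜ →
      DifferentiableAt ℝ (γ α.1 β.1 α.2 β.2) z := by
    rw [ae_all_iff]
    intro α
    rw [ae_all_iff]
    intro β
    exact ae_differentiableAt_of_locallyLipschitzOn volume (isOpen_Ioo.prod h.isClosed.isOpen_compl)
      ((h.lipschitz _ _ _ _).mono (prod_mono Ioo_subset_Icc_self le_rfl))
  filter_upwards [h1, (lipschitzWith_obstacleCutoff (K := K) (n := n)).ae_differentiableAt,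
    hL.ae_differentiableAt] with z h1 h2 h3 hz
  exact ⟨fun α β => h1 α β hz, h2, h3⟩

theorem differentiableAt_grad (h : IsCoercive T K c γ w F lam Γ) {z : Spacetime}
    (hz : z ∈ Ioo 0 T ×ˢ Kᶜ) (α : Fin N × Fin 4) : DifferentiableAt ℝ (grad T K w α) z := by
  refine ((contDiffOn_pd h.isClosed (h.solution.contDiffOn α.1) α.2).contDiffAt ?_).differentiableAt
    (by norm_num)
  exact mem_of_superset ((isOpen_Ioo.prod h.isClosed.isOpen_compl).mem_nhds hz)
    (prod_mono (fun t ht => ht.2.le) le_rfl)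

/-- This is where the differential equation enters, at points where the second derivatives of w are
classical and commute. -/
theorem sum_fluxDeriv_eq (h : IsCoercive T K c γ w F lam Γ) {z : Spacetime}
    (hz : z ∈ Ioo 0 T ×ˢ Kᶜ) :
    ∑ j, fluxDeriv (fun α β => coeff c γ α β z)
        (fun α β => fderiv ℝ (γ α.1 β.1 α.2 β.2) z (dir j)) (fun α => grad T K w α z)
        (fun α => fderiv ℝ (grad T K w α) z (dir j)) j =
      work T K w F z + coeffError (fun α => grad T K w α z)
        (fun j α β => fderiv ℝ (γ α.1 β.1 α.2 β.2) z (dir j)) := by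
  have hz' : z ∈ Iio T ×ˢ Kᶜ := ⟨hz.1.2, hz.2⟩
  have hzS : z ∈ Icc 0 T ×ˢ Kᶜ := ⟨Ioo_subset_Icc_self hz.1, hz.2⟩
  have hD : ∀ j α, fderiv ℝ (grad T K w α) z (dir j) =
      pd (domain T K) j (pd (domain T K) α.2 (w α.1)) z := fun j α =>
    (pd_eq_fderiv h.isClosed hz' j).symm
  rw [sum_fluxDeriv (Dg := fun j α β => fderiv ℝ (γ α.1 β.1 α.2 β.2) z (dir j))
    (Du := fun j α => fderiv ℝ (grad T K w α) z (dir j))]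
  · congr 1
    refine Finset.sum_congr rfl fun I _ => ?_
    rw [sum_coeff_mul]
    simp only [hD]
    have := h.solution.equation I z.1 hz.1 z.2 hz.2
    rw [← this]
    rfl
  · intro α β
    simp only [coeff]
    have h1 : boxCoeff c α β = boxCoeff c β α := by
      by_cases hαβ : α = β
      · rw [hαβ]
      · simp [boxCoeff, hαβ, Ne.symm hαβ]
    -- Symmetry of the matrix combines both conditions: exchange the components, then the
    -- directions.
    rw [h1, (h.symmetric α.1 β.1 α.2 β.2 z hzS).1, (h.symmetric β.1 α.1 α.2 β.2 z hzS).2]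
  · intro j I
    simp only [hD]
    exact pd_comm h.isClosed (h.solution.contDiffOn I) hz' _ _

theorem lineDeriv_cutFlux (h : IsCoercive T K c γ w F lam Γ) {M R : ℝ} {n : ℕ} {z : Spacetime}
    (hz : z ∈ Ioo 0 T ×ˢ Kᶜ)
    (hγ : ∀ α β : Fin N × Fin 4, DifferentiableAt ℝ (γ α.1 β.1 α.2 β.2) z)
    (hη : DifferentiableAt ℝ (obstacleCutoff K n) z)
    (hχ : DifferentiableAt ℝ (coneCutoff M R) z) (j : Fin 4) :
    lineDeriv ℝ (cutFlux T K c γ w M R n j) z (dir j) =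
      (fderiv ℝ (obstacleCutoff K n) z (dir j) * coneCutoff M R z +
        obstacleCutoff K n z * fderiv ℝ (coneCutoff M R) z (dir j)) * fluxAt T K c γ w j z +
      obstacleCutoff K n z * coneCutoff M R z * fluxDeriv (fun α β => coeff c γ α β z)
        (fun α β => fderiv ℝ (γ α.1 β.1 α.2 β.2) z (dir j)) (fun α => grad T K w α z)
        (fun α => fderiv ℝ (grad T K w α) z (dir j)) j := by
  have h1 := hη.hasFDerivAt.hasLineDerivAt (dir j)
  have h2 := hχ.hasFDerivAt.hasLineDerivAt (dir j)
  have h3 : ∀ α β, HasDerivAt (fun s : ℝ => coeff c γ α β (z + s • dir j))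
      (fderiv ℝ (γ α.1 β.1 α.2 β.2) z (dir j)) 0 := fun α β =>
    HasDerivAt.const_add _ ((hγ α β).hasFDerivAt.hasLineDerivAt (dir j))
  have h4 : ∀ α, HasDerivAt (fun s : ℝ => grad T K w α (z + s • dir j))
      (fderiv ℝ (grad T K w α) z (dir j)) 0 := fun α =>
    (h.differentiableAt_grad hz α).hasFDerivAt.hasLineDerivAt (dir j)
  have h5 := (HasDerivAt.mul (HasDerivAt.mul h1 h2) (hasDerivAt_flux h3 h4 j)).deriv
  simp only [Pi.mul_apply, zero_smul, add_zero] at h5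
  exact h5

/-- The divergence of the cut off energy flux is bounded by the work of the force, an error from
the derivatives of the coefficients, and an error supported near the obstacle. -/
theorem sum_lineDeriv_cutFlux_le (h : IsCoercive T K c γ w F lam Γ) {M R : ℝ} (hM : 0 < M)
    (hR : 0 < R) (hΓM : 3 * Γ ≤ lam * M) {n : ℕ} {z : Spacetime} (hz : z ∈ Ioo 0 T ×ˢ Kᶜ)
    (hγ : ∀ α β : Fin N × Fin 4, DifferentiableAt ℝ (γ α.1 β.1 α.2 β.2) z)
    (hη : DifferentiableAt ℝ (obstacleCutoff K n) z)
    (hχ : DifferentiableAt ℝ (coneCutoff M R) z) {B : ℝ} (hB : 0 ≤ B)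
    (hgB : ‖z.2‖ ≤ R → ∀ α, |grad T K w α z| ≤ B)
    (hgd : ‖z.2‖ ≤ R → ∀ I, |grad T K w (I, 0) z| ≤ B * Metric.infDist z.2 K) :
    ∑ j, lineDeriv ℝ (cutFlux T K c γ w M R n j) z (dir j) ≤
      coneCutoff M R z * |work T K w F z| +
        2 * derivSum T K γ z * (coneCutoff M R z * gradSq T K w z) +
        (layer K R n).indicator (fun _ => 6 * Γ * B ^ 2) z.2 := by
  have hz' : z ∈ Iio T ×ˢ Kᶜ := ⟨hz.1.2, hz.2⟩
  have hzS : z ∈ Icc 0 T ×ˢ Kᶜ := ⟨Ioo_subset_Icc_self hz.1, hz.2⟩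
  have hχ0 : 0 ≤ coneCutoff M R z := coneCutoff_nonneg
  have hχ1 : coneCutoff M R z ≤ 1 := coneCutoff_le_one hM.le hR hz.1.1.le
  have hη0 : 0 ≤ obstacleCutoff K n z := obstacleCutoff_nonneg
  have hη1 : obstacleCutoff K n z ≤ 1 := obstacleCutoff_le_one
  have hd0 : 0 ≤ Metric.infDist z.2 K := Metric.infDist_nonneg
  simp only [h.lineDeriv_cutFlux hz hγ hη hχ]
  rw [Finset.sum_add_distrib, ← Finset.mul_sum, h.sum_fluxDeriv_eq hz]
  have hflux : ∀ k : Fin 3, |fluxAt T K c γ w k.succ z| ≤ Γ * gradSq T K w z := fun k =>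
    (abs_flux_le (fun I β => abs_mul_le_sqLen _ _ _) (sqLen_nonneg _) k).trans
      (mul_le_mul_of_nonneg_right (h.bounded z hzS) (sqLen_nonneg _))
  have hcut := sum_cutoff_flux_le (η := obstacleCutoff K n z) (χ := coneCutoff M R z)
    (Dη := fun j => fderiv ℝ (obstacleCutoff K n) z (dir j))
    (Dχ := fun j => fderiv ℝ (coneCutoff M R) z (dir j)) (p := fun j => fluxAt T K c γ w j z)
    (s := gradSq T K w z) (E := (layer K R n).indicator (fun _ => 2 * Γ * B ^ 2) z.2)
    hη0 (fderiv_obstacleCutoff_time hη) hχ0 hM hΓM (sqLen_nonneg _)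
    (fderiv_coneCutoff_time_nonpos hR hM.le hχ) (abs_fderiv_coneCutoff_le hR hM.le hχ)
    (h.coercive z hzS _) hflux ?_
  · have hw : obstacleCutoff K n z * coneCutoff M R z * work T K w F z ≤
        coneCutoff M R z * |work T K w F z| := by
      calc obstacleCutoff K n z * coneCutoff M R z * work T K w F z
          ≤ obstacleCutoff K n z * coneCutoff M R z * |work T K w F z| := by
            gcongr
            exact le_abs_self _
        _ ≤ 1 * coneCutoff M R z * |work T K w F z| := by gcongr
        _ = _ := by rw [one_mul]
    have hds : ∑ j : Fin 4, ∑ α : Fin N × Fin 4, ∑ β : Fin N × Fin 4,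
        |fderiv ℝ (γ α.1 β.1 α.2 β.2) z (dir j)| = derivSum T K γ z := by
      simp only [derivSum, pd_eq_fderiv h.isClosed hz']
    have he := abs_coeffError_le (fun α => grad T K w α z)
      (fun j α β => fderiv ℝ (γ α.1 β.1 α.2 β.2) z (dir j))
    rw [hds] at he
    have hds0 : 0 ≤ derivSum T K γ z := derivSum_nonneg z
    have hgs0 : 0 ≤ gradSq T K w z := gradSq_nonneg z
    have he' : obstacleCutoff K n z * coneCutoff M R z * coeffError (fun α => grad T K w α z)
        (fun j α β => fderiv ℝ (γ α.1 β.1 α.2 β.2) z (dir j)) ≤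
        2 * derivSum T K γ z * (coneCutoff M R z * gradSq T K w z) := by
      calc _ ≤ obstacleCutoff K n z * coneCutoff M R z * (2 * derivSum T K γ z * gradSq T K w z) := by
            gcongr
            exact (le_abs_self _).trans he
        _ ≤ 1 * coneCutoff M R z * (2 * derivSum T K γ z * gradSq T K w z) := by gcongr
        _ = _ := by ring
    -- The factor 3 counts the spatial directions.
    have hind : (layer K R n).indicator (fun _ => 6 * Γ * B ^ 2) z.2 =
        3 * (layer K R n).indicator (fun _ => 2 * Γ * B ^ 2) z.2 := by
      by_cases hl : z.2 ∈ layer K R n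
      · simp only [indicator_of_mem hl]
        ring
      · simp only [indicator_of_notMem hl, mul_zero]
    rw [mul_add, hind]
    linarith
  · intro k
    by_cases hzR : R ≤ ‖z.2‖
    · rw [coneCutoff_eq_zero hM.le hR hz.1.1.le hzR, zero_mul]
      exact indicator_nonneg (fun _ _ => mul_nonneg (mul_nonneg zero_le_two h.Γ_nonneg)
        (sq_nonneg B)) _
    push Not at hzR
    by_cases hl : 2 < (n + 1) * Metric.infDist z.2 K
    · simp only [fderiv_obstacleCutoff_eq_zero hl]
      simp only [zero_apply, abs_zero, zero_mul, mul_zero]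
      exact indicator_nonneg (fun _ _ => mul_nonneg (mul_nonneg zero_le_two h.Γ_nonneg)
        (sq_nonneg B)) _
    push Not at hl
    rw [indicator_of_mem (show z.2 ∈ layer K R n from ⟨hz.2, hl, hzR.le⟩)]
    have hfl : |fluxAt T K c γ w k.succ z| ≤ Γ * (B * Metric.infDist z.2 K * B) := by
      refine (abs_flux_le (B := B * Metric.infDist z.2 K * B) (fun I β => ?_) (by positivity)
        k).trans (mul_le_mul_of_nonneg_right (h.bounded z hzS) (by positivity))
      rw [abs_mul]
      have := hgB hzR.le β
      have := hgd hzR.le I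
      gcongr
    have hΓ := h.Γ_nonneg
    -- The slope n + 1 of the cutoff is compensated by the factor dist(x, K) in the flux: their
    -- product is at most 2 in the layer, so the bound does not depend on n.
    calc coneCutoff M R z * (|fderiv ℝ (obstacleCutoff K n) z (dir k.succ)| *
          |fluxAt T K c γ w k.succ z|)
        ≤ 1 * (((n : ℝ) + 1) * (Γ * (B * Metric.infDist z.2 K * B))) := by
          have := abs_fderiv_obstacleCutoff_le (K := K) (n := n) (z := z) k.succ
          gcongr
      _ = ((n : ℝ) + 1) * Metric.infDist z.2 K * (Γ * B ^ 2) := by ring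
      _ ≤ 2 * (Γ * B ^ 2) := by gcongr
      _ = 2 * Γ * B ^ 2 := by ring

end IsCoercive

/-! ### The localized energy inequality, with the obstacle cutoff removed. -/

theorem ofReal_integral_le_lintegral {X : Type*} [MeasurableSpace X] {μ : Measure X} {f : X → ℝ}
    (hf : Integrable f μ) : ENNReal.ofReal (∫ x, f x ∂μ) ≤ ∫⁻ x, ENNReal.ofReal (f x) ∂μ := by
  calc ENNReal.ofReal (∫ x, f x ∂μ) ≤ ENNReal.ofReal (∫ x, max (f x) 0 ∂μ) :=
        ENNReal.ofReal_le_ofReal (integral_mono hf hf.pos_part fun x => le_max_left _ _)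
    _ = ∫⁻ x, ENNReal.ofReal (max (f x) 0) ∂μ :=
        ofReal_integral_eq_lintegral_ofReal hf.pos_part (ae_of_all _ fun x => le_max_right _ _)
    _ = ∫⁻ x, ENNReal.ofReal (f x) ∂μ := by simp

theorem measurableSet_layer (hK : IsClosed K) (R : ℝ) (n : ℕ) : MeasurableSet (layer K R n) := by
  refine hK.isOpen_compl.measurableSet.inter (MeasurableSet.inter ?_ ?_)
  · exact (isClosed_le (continuous_const.mul (Metric.continuous_infDist_pt K))
      continuous_const).measurableSet
  · exact (isClosed_le continuous_norm continuous_const).measurableSet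

/-- The layers decrease to the empty set, since points off the closed set K have positive distance
to it, and they have finite volume. As ∂K is excluded from them, its measure is irrelevant. -/
theorem tendsto_volume_layer (hK : IsClosed K) (hKn : K.Nonempty) (R : ℝ) :
    Tendsto (fun n => volume (layer K R n)) atTop (𝓝 0) := by
  have h1 : Antitone (layer K R) := by
    rintro m n hmn x ⟨hx, hd, hR⟩
    refine ⟨hx, le_trans ?_ hd, hR⟩
    have := Metric.infDist_nonneg (x := x) (s := K)
    gcongr
  have h2 : ⋂ n, layer K R n = ∅ := by
    refine eq_empty_of_forall_notMem fun x hx => ?_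
    rw [mem_iInter] at hx
    have hd : 0 < Metric.infDist x K := (hK.notMem_iff_infDist_pos hKn).1 (hx 0).1
    obtain ⟨m, hm⟩ := exists_nat_gt (2 / Metric.infDist x K)
    rw [div_lt_iff₀ hd] at hm
    have := (hx m).2.1
    linarith
  have h3 := tendsto_measure_iInter_atTop (μ := volume) (s := layer K R)
    (fun n => (measurableSet_layer hK R n).nullMeasurableSet) h1
    ⟨0, ((measure_mono fun x hx => by simpa using hx.2.2).trans_lt
      (measure_closedBall_lt_top (x := (0 : Space)) (r := R))).ne⟩
  rw [h2, measure_empty] at h3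
  exact h3

/-- The localized energy. -/
def energy (T : ℝ) (K : Set Space) (w : Fin N → Spacetime → ℝ) (M R t : ℝ) : ℝ≥0∞ :=
  ∫⁻ x in Kᶜ, ENNReal.ofReal (coneCutoff M R (t, x) * gradSq T K w (t, x))

/-- The bound for the growth rate of the localized energy. -/
def growth (T : ℝ) (K : Set Space) (γ : Fin N → Fin N → Fin 4 → Fin 4 → Spacetime → ℝ)
    (w F : Fin N → Spacetime → ℝ) (M R s : ℝ) : ℝ≥0∞ :=
  ∫⁻ x in Kᶜ, (ENNReal.ofReal (coneCutoff M R (s, x) * |work T K w F (s, x)|) +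
    ENNReal.ofReal (2 * derivSum T K γ (s, x) * (coneCutoff M R (s, x) * gradSq T K w (s, x))))

namespace IsCoercive

theorem exists_bound_grad (h : IsCoercive T K c γ w F lam Γ) (R : ℝ) :
    ∃ B, 0 ≤ B ∧ ∀ t ∈ Icc 0 T, ∀ x ∈ Kᶜ, ‖x‖ ≤ R → (∀ α, |grad T K w α (t, x)| ≤ B) ∧
      ∀ I, |grad T K w (I, 0) (t, x)| ≤ B * Metric.infDist x K := by
  choose B hB using fun I => exists_bound_pd h.pos h.isClosed h.nonempty
    (h.solution.contDiffOn I) (h.solution.boundary I) R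
  have hle : ∀ I, B I ≤ ∑ I, |B I| := fun I => (le_abs_self _).trans
    (Finset.single_le_sum (f := fun I => |B I|) (fun _ _ => abs_nonneg _) (Finset.mem_univ I))
  refine ⟨∑ I, |B I|, Finset.sum_nonneg fun _ _ => abs_nonneg _, fun t ht x hx hR => ⟨?_, ?_⟩⟩
  · intro α
    exact ((hB α.1 t ht x hx hR).1 α.2).trans (hle _)
  · intro I
    exact (hB I t ht x hx hR).2.trans
      (mul_le_mul_of_nonneg_right (hle I) Metric.infDist_nonneg)

theorem cutFlux_initial (h : IsCoercive T K c γ w F lam Γ) (M R : ℝ) (n : ℕ) (j : Fin 4)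
    (x : Space) : cutFlux T K c γ w M R n j (0, x) = 0 := by
  by_cases hx : x ∈ K
  · rw [cutFlux, obstacleCutoff_eq_zero_of_mem hx, zero_mul, zero_mul]
  · have hg : ∀ α, grad T K w α (0, x) = 0 := fun α =>
      pd_eq_zero_of_nonpos h.pos h.isClosed (h.solution.contDiffOn α.1)
        (h.solution.initial α.1) le_rfl hx α.2
    simp [cutFlux, fluxAt, flux, hg]

theorem lineDeriv_cutFlux_of_mem {M R : ℝ} {n : ℕ} {j : Fin 4} {z : Spacetime} (hz : z.2 ∈ K)
    (v : Spacetime) : lineDeriv ℝ (cutFlux T K c γ w M R n j) z v = 0 := by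
  have hc : Continuous fun y : Spacetime => (n + 1 : ℝ) * Metric.infDist y.2 K :=
    continuous_const.mul ((Metric.continuous_infDist_pt K).comp continuous_snd)
  have h0 : (n + 1 : ℝ) * Metric.infDist z.2 K < 1 := by
    rw [Metric.infDist_zero_of_mem hz]
    simp
  have : cutFlux T K c γ w M R n j =ᶠ[𝓝 z] fun _ => 0 := by
    filter_upwards [hc.continuousAt.eventually_lt_const h0] with y hy
    rw [cutFlux, obstacleCutoff_eq_zero hy.le, zero_mul, zero_mul]
  rw [this.lineDeriv_eq, lineDeriv, deriv_const]

/-- The energy inequality for the energy which is cut off near the obstacle. -/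
theorem truncated_energy_le (h : IsCoercive T K c γ w F lam Γ) {M R : ℝ} (hM : 0 < M)
    (hR : 0 < R) (hΓM : 3 * Γ ≤ lam * M) :
    ∃ B : ℝ, ∀ n, ∀ t ∈ Icc 0 T,
      ENNReal.ofReal lam * ∫⁻ x in Kᶜ, ENNReal.ofReal (obstacleCutoff K n (t, x) *
          (coneCutoff M R (t, x) * gradSq T K w (t, x))) ≤
        (∫⁻ s in Ioc 0 t, growth T K γ w F M R s) +
          ENNReal.ofReal B * ENNReal.ofReal T * volume (layer K R n) := by
  obtain ⟨B, hB0, hB⟩ := h.exists_bound_grad R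
  -- The constant is chosen before n, so that the shrinking volume of the layer kills the error
  -- term.
  refine ⟨6 * Γ * B ^ 2, fun n t ht => ?_⟩
  set H := cutFlux T K c γ w M R n with hH
  choose L hL using fun j => h.exists_lipschitzOnWith_cutFlux hM.le hR n j
  have hL' : ∀ j, LipschitzOnWith (∑ j, L j) (H j) (Icc 0 T ×ˢ univ) := fun j =>
    (hL j).weaken (Finset.single_le_sum (f := L) (fun _ _ => zero_le) (Finset.mem_univ j))
  have hHR : ∀ j, ∀ s ∈ Icc 0 T, ∀ x, R ≤ ‖x‖ → H j (s, x) = 0 := fun j s hs x hx =>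
    cutFlux_eq_zero hM.le hR hs.1 (Or.inr hx)
  obtain ⟨hint, hdiv⟩ := integral_divergence h.pos.le ht hL' hHR
  have hzero : ∫ x, H 0 (0, x) = 0 := by
    simp only [hH, h.cutFlux_initial, integral_zero]
  rw [hzero, sub_zero] at hdiv
  have hlow : ∀ x ∈ Kᶜ, lam * (obstacleCutoff K n (t, x) *
      (coneCutoff M R (t, x) * gradSq T K w (t, x))) ≤ H 0 (t, x) := by
    intro x hx
    have h1 := h.coercive (t, x) ⟨ht, hx⟩ fun α => grad T K w α (t, x)
    have h2 : 0 ≤ obstacleCutoff K n (t, x) * coneCutoff M R (t, x) :=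
      mul_nonneg obstacleCutoff_nonneg coneCutoff_nonneg
    calc _ = obstacleCutoff K n (t, x) * coneCutoff M R (t, x) * (lam * gradSq T K w (t, x)) := by
          ring
      _ ≤ _ := mul_le_mul_of_nonneg_left h1 h2
  have hHK : ∀ x ∈ K, H 0 (t, x) = 0 := fun x hx => by
    simp only [hH, cutFlux]
    rw [obstacleCutoff_eq_zero_of_mem hx, zero_mul, zero_mul]
  have hHnn : ∀ x, 0 ≤ H 0 (t, x) := by
    intro x
    by_cases hx : x ∈ K
    · rw [hHK x hx]
    · refine le_trans ?_ (hlow x hx)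
      exact mul_nonneg h.lam_pos.le (mul_nonneg obstacleCutoff_nonneg
        (mul_nonneg coneCutoff_nonneg (gradSq_nonneg _)))
  have hHint : Integrable fun x => H 0 (t, x) := by
    have hc : Continuous fun x => H 0 (t, x) :=
      (hL' 0).continuousOn.comp_continuous (by fun_prop) fun x => ⟨ht, mem_univ _⟩
    refine hc.integrable_of_hasCompactSupport ?_
    refine HasCompactSupport.intro (isCompact_closedBall (0 : Space) R) fun x hx => hHR 0 t ht x ?_
    have : R < ‖x‖ := by simpa using hx
    exact this.le
  have hKm : MeasurableSet Kᶜ := h.isClosed.isOpen_compl.measurableSet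
  have hae : ∀ᵐ z ∂((volume.restrict (Ioo 0 t)).prod (volume : Measure Space)), z.2 ∈ Kᶜ →
      ∑ j, lineDeriv ℝ (H j) z (dir j) ≤ coneCutoff M R z * |work T K w F z| +
        2 * derivSum T K γ z * (coneCutoff M R z * gradSq T K w z) +
        (layer K R n).indicator (fun _ => 6 * Γ * B ^ 2) z.2 := by
    have h1 : (volume.restrict (Ioo 0 t)).prod (volume : Measure Space) =
        (volume : Measure Spacetime).restrict (Ioo 0 t ×ˢ univ) := by
      rw [Measure.volume_eq_prod, ← Measure.prod_restrict, Measure.restrict_univ]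
    rw [h1]
    filter_upwards [ae_restrict_mem (measurableSet_Ioo.prod MeasurableSet.univ),
      ae_restrict_of_ae (h.ae_differentiableAt M R n)] with z hz hd hzK
    have hzT : z ∈ Ioo 0 T ×ˢ Kᶜ := ⟨⟨hz.1.1, hz.1.2.trans_le ht.2⟩, hzK⟩
    obtain ⟨hd1, hd2, hd3⟩ := hd hzT
    refine h.sum_lineDeriv_cutFlux_le hM hR hΓM hzT hd1 hd2 hd3 hB0 ?_ ?_
    · intro hzR
      exact (hB z.1 (Ioo_subset_Icc_self hzT.1) z.2 hzK hzR).1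
    · intro hzR
      exact (hB z.1 (Ioo_subset_Icc_self hzT.1) z.2 hzK hzR).2
  calc ENNReal.ofReal lam * ∫⁻ x in Kᶜ, ENNReal.ofReal (obstacleCutoff K n (t, x) *
          (coneCutoff M R (t, x) * gradSq T K w (t, x)))
      = ∫⁻ x in Kᶜ, ENNReal.ofReal (lam * (obstacleCutoff K n (t, x) *
          (coneCutoff M R (t, x) * gradSq T K w (t, x)))) := by
        rw [← lintegral_const_mul' _ _ ENNReal.ofReal_ne_top]
        simp only [ENNReal.ofReal_mul h.lam_pos.le]
    _ ≤ ∫⁻ x in Kᶜ, ENNReal.ofReal (H 0 (t, x)) :=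
        setLIntegral_mono' hKm fun x hx => ENNReal.ofReal_le_ofReal (hlow x hx)
    _ ≤ ∫⁻ x, ENNReal.ofReal (H 0 (t, x)) := setLIntegral_le_lintegral _ _
    _ = ENNReal.ofReal (∫ x, H 0 (t, x)) :=
        (ofReal_integral_eq_lintegral_ofReal hHint (ae_of_all _ hHnn)).symm
    -- Discarding the negative part allows bounds by possibly infinite integrals of F and of the
    -- derivatives of γ.
    _ ≤ ∫⁻ z, ENNReal.ofReal (∑ j, lineDeriv ℝ (H j) z (dir j))
          ∂((volume.restrict (Ioo 0 t)).prod (volume : Measure Space)) := by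
        rw [← hdiv]
        exact ofReal_integral_le_lintegral hint
    _ = ∫⁻ s in Ioo 0 t, ∫⁻ x, ENNReal.ofReal (∑ j, lineDeriv ℝ (H j) (s, x) (dir j)) :=
        lintegral_prod _ hint.aestronglyMeasurable.aemeasurable.ennreal_ofReal
    _ ≤ ∫⁻ s in Ioo 0 t, (growth T K γ w F M R s +
          ENNReal.ofReal (6 * Γ * B ^ 2) * volume (layer K R n)) := by
        refine lintegral_mono_ae ?_
        filter_upwards [Measure.ae_ae_of_ae_prod hae] with s hs
        calc ∫⁻ x, ENNReal.ofReal (∑ j, lineDeriv ℝ (H j) (s, x) (dir j))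
            = ∫⁻ x in Kᶜ, ENNReal.ofReal (∑ j, lineDeriv ℝ (H j) (s, x) (dir j)) := by
              refine (setLIntegral_eq_of_support_subset ?_).symm
              intro x hx hxK
              refine hx ?_
              simp only [hH]
              rw [Finset.sum_eq_zero fun j _ => lineDeriv_cutFlux_of_mem hxK _, ENNReal.ofReal_zero]
          _ ≤ ∫⁻ x in Kᶜ, ((ENNReal.ofReal (coneCutoff M R (s, x) * |work T K w F (s, x)|) +
                ENNReal.ofReal (2 * derivSum T K γ (s, x) *
                  (coneCutoff M R (s, x) * gradSq T K w (s, x)))) +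
                (layer K R n).indicator (fun _ => ENNReal.ofReal (6 * Γ * B ^ 2)) x) := by
              refine lintegral_mono_ae ?_
              filter_upwards [ae_restrict_mem hKm, ae_restrict_of_ae hs] with x hxK hx
              refine (ENNReal.ofReal_le_ofReal (hx hxK)).trans (ENNReal.ofReal_add_le.trans ?_)
              gcongr
              · exact ENNReal.ofReal_add_le
              · by_cases hl : x ∈ layer K R n
                · simp [hl]
                · simp [hl]
          _ = growth T K γ w F M R s + ∫⁻ x in Kᶜ,
                (layer K R n).indicator (fun _ => ENNReal.ofReal (6 * Γ * B ^ 2)) x := by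
              rw [lintegral_add_right _
                (measurable_const.indicator (measurableSet_layer h.isClosed R n)), growth]
          _ ≤ _ := by
              gcongr
              refine (setLIntegral_le_lintegral _ _).trans ?_
              rw [lintegral_indicator_const (measurableSet_layer h.isClosed R n)]
    _ = (∫⁻ s in Ioo 0 t, growth T K γ w F M R s) +
          ENNReal.ofReal (6 * Γ * B ^ 2) * volume (layer K R n) * ENNReal.ofReal t := by
        rw [lintegral_add_right _ measurable_const]
        simp
    _ ≤ _ := by
        rw [mul_right_comm]
        have := ht.2
        gcongr
        exact Ioo_subset_Ioc_self

theorem measurable_gradSq_slice (h : IsCoercive T K c γ w F lam Γ) {t : ℝ} (ht : t ∈ Icc 0 T) :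
    AEMeasurable (fun x => gradSq T K w (t, x)) (volume.restrict Kᶜ) := by
  have hc : ContinuousOn (fun x => gradSq T K w (t, x)) Kᶜ := by
    refine continuousOn_finsetSum _ fun α _ => ContinuousOn.pow ?_ 2
    exact (h.locallyLipschitzOn_grad α).continuousOn.comp (by fun_prop) fun x hx => ⟨ht, hx⟩
  exact hc.aemeasurable h.isClosed.isOpen_compl.measurableSet

/-- Let n → ∞: the obstacle cutoff increases to 1 off K, so the left side converges monotonically,
while the layer error tends to 0. -/
theorem energy_le (h : IsCoercive T K c γ w F lam Γ) {M R : ℝ} (hM : 0 < M)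
    (hR : 0 < R) (hΓM : 3 * Γ ≤ lam * M) {t : ℝ} (ht : t ∈ Icc 0 T) :
    ENNReal.ofReal lam * energy T K w M R t ≤ ∫⁻ s in Ioc 0 t, growth T K γ w F M R s := by
  obtain ⟨B, hB⟩ := h.truncated_energy_le hM hR hΓM
  have hKm : MeasurableSet Kᶜ := h.isClosed.isOpen_compl.measurableSet
  have hχ : Continuous fun x : Space => coneCutoff M R (t, x) :=
    continuous_coneCutoff.comp (by fun_prop)
  have hη : ∀ n, Continuous fun x : Space => obstacleCutoff K n (t, x) := fun n =>
    (lipschitzWith_obstacleCutoff (K := K) (n := n)).continuous.comp (by fun_prop)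
  have h1 : Tendsto (fun n => ENNReal.ofReal lam * ∫⁻ x in Kᶜ, ENNReal.ofReal
      (obstacleCutoff K n (t, x) * (coneCutoff M R (t, x) * gradSq T K w (t, x)))) atTop
      (𝓝 (ENNReal.ofReal lam * energy T K w M R t)) := by
    refine ENNReal.Tendsto.const_mul ?_ (Or.inr ENNReal.ofReal_ne_top)
    refine lintegral_tendsto_of_tendsto_of_monotone ?_ ?_ ?_
    · intro n
      exact ((hη n).aemeasurable.mul
        (hχ.aemeasurable.mul (h.measurable_gradSq_slice ht))).ennreal_ofReal
    · refine ae_of_all _ fun x => ?_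
      intro m n hmn
      refine ENNReal.ofReal_le_ofReal ?_
      exact mul_le_mul_of_nonneg_right (obstacleCutoff_mono (z := ((t, x) : Spacetime)) hmn)
        (mul_nonneg coneCutoff_nonneg (gradSq_nonneg _))
    · filter_upwards [ae_restrict_mem hKm] with x hx
      refine ENNReal.tendsto_ofReal ?_
      have := (tendsto_obstacleCutoff (z := (t, x))
        ((h.isClosed.notMem_iff_infDist_pos h.nonempty).1 hx)).mul_const
          (coneCutoff M R (t, x) * gradSq T K w (t, x))
      simpa using this
  have h2 : Tendsto (fun n => (∫⁻ s in Ioc 0 t, growth T K γ w F M R s) +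
      ENNReal.ofReal B * ENNReal.ofReal T * volume (layer K R n)) atTop
      (𝓝 (∫⁻ s in Ioc 0 t, growth T K γ w F M R s)) := by
    have := (ENNReal.Tendsto.const_mul (a := ENNReal.ofReal B * ENNReal.ofReal T)
      (tendsto_volume_layer h.isClosed h.nonempty R)
      (Or.inr (ENNReal.mul_ne_top ENNReal.ofReal_ne_top ENNReal.ofReal_ne_top))).const_add
      (∫⁻ s in Ioc 0 t, growth T K γ w F M R s)
    simpa using this
  exact le_of_tendsto_of_tendsto' h1 h2 fun n => hB n t ht

end IsCoercive

/-! ### Essential suprema of the coefficients and measurability in time. -/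

/-- If the bound failed at z, it would fail on a relatively open neighbourhood. This meets the open
set (0, T) × U, even when z has an extreme time, and so has positive measure. -/
theorem enorm_le_eLpNorm_top_of_continuousOn {U : Set Space} (hT : 0 < T) (hU : IsOpen U)
    {f : Spacetime → ℝ} (hf : ContinuousOn f (Icc 0 T ×ˢ U)) {z : Spacetime}
    (hz : z ∈ Icc 0 T ×ˢ U) : ‖f z‖ₑ ≤ eLpNorm f ⊤ (volume.restrict (Icc 0 T ×ˢ U)) := by
  by_contra hcon
  push Not at hcon
  rw [eLpNorm_exponent_top] at hcon
  obtain ⟨O, hO, hzO, hOS⟩ := mem_nhdsWithin.1 ((hf z hz).enorm.eventually_const_lt hcon)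
  have hne : (O ∩ Ioo 0 T ×ˢ U).Nonempty := by
    have hcl : z ∈ closure (Ioo 0 T ×ˢ U) := by
      rw [closure_prod_eq, closure_Ioo hT.ne]
      exact ⟨hz.1, subset_closure hz.2⟩
    exact mem_closure_iff.1 hcl O hO hzO
  have hopen : IsOpen (O ∩ Ioo 0 T ×ˢ U) := hO.inter (isOpen_Ioo.prod hU)
  have hpos := hopen.measure_pos volume hne
  have hsub : Ioo 0 T ×ˢ U ⊆ Icc 0 T ×ˢ U := prod_mono Ioo_subset_Icc_self le_rfl
  have hnull : (volume.restrict (Icc 0 T ×ˢ U)) (O ∩ Ioo 0 T ×ˢ U) = 0 := by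
    refine measure_mono_null (fun y hy => ?_) (ae_le_eLpNormEssSup (f := f)
      (μ := volume.restrict (Icc 0 T ×ˢ U)))
    have hlt : eLpNormEssSup f (volume.restrict (Icc 0 T ×ˢ U)) < ‖f y‖ₑ := hOS ⟨hy.1, hsub hy.2⟩
    exact not_le.2 hlt
  rw [Measure.restrict_apply hopen.measurableSet, inter_eq_left.2
    (inter_subset_right.trans hsub)] at hnull
  exact hpos.ne' hnull

theorem sum_abs_le_of_supNorm_le (hT : 0 < T) (hK : IsClosed K)
    (hγ : ∀ I J j k, LocallyLipschitzOn (Icc 0 T ×ˢ Kᶜ) (γ I J j k)) {δ : ℝ≥0}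
    (hδ : supNorm T K γ ≤ δ) {z : Spacetime} (hz : z ∈ Icc 0 T ×ˢ Kᶜ) :
    ∑ α : Fin N × Fin 4, ∑ β : Fin N × Fin 4, |γ α.1 β.1 α.2 β.2 z| ≤ δ := by
  have h1 : ∑ α : Fin N × Fin 4, ∑ β : Fin N × Fin 4, ‖γ α.1 β.1 α.2 β.2 z‖ₑ ≤ δ := by
    refine le_trans ?_ hδ
    simp only [Fintype.sum_prod_type, supNorm]
    refine Finset.sum_le_sum fun I _ => ?_
    rw [Finset.sum_comm]
    refine Finset.sum_le_sum fun J _ => Finset.sum_le_sum fun j _ => Finset.sum_le_sum fun k _ => ?_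
    exact enorm_le_eLpNorm_top_of_continuousOn hT hK.isOpen_compl (hγ I J j k).continuousOn hz
  have h2 : ∑ α : Fin N × Fin 4, ∑ β : Fin N × Fin 4, ‖γ α.1 β.1 α.2 β.2 z‖₊ ≤ δ := by
    have h3 : ((∑ α : Fin N × Fin 4, ∑ β : Fin N × Fin 4, ‖γ α.1 β.1 α.2 β.2 z‖₊ : ℝ≥0) : ℝ≥0∞) ≤ δ := by
      push_cast
      exact h1
    exact_mod_cast h3
  have h4 : ((∑ α : Fin N × Fin 4, ∑ β : Fin N × Fin 4, ‖γ α.1 β.1 α.2 β.2 z‖₊ : ℝ≥0) : ℝ) ≤ δ := by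
    exact_mod_cast h2
  simpa using h4

/-- The sum of the suprema over space of all first derivatives of the coefficients. -/
def derivSup (T : ℝ) (K : Set Space) (γ : Fin N → Fin N → Fin 4 → Fin 4 → Spacetime → ℝ)
    (t : ℝ) : ℝ≥0∞ :=
  ∑ I, ∑ J, ∑ i, ∑ j, ∑ k,
    eLpNorm (fun x : Space => pd (domain T K) i (γ I J j k) (t, x)) ⊤ (volume.restrict Kᶜ)

/-- The essential supremum of a slice is at most a exactly when the slice of {‖f‖ > a} is null, and
measures of slices are measurable. -/
theorem measurable_eLpNorm_top_slice {X Y : Type*} [MeasurableSpace X] [MeasurableSpace Y]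
    {ν : Measure Y} [SFinite ν] {f : X × Y → ℝ} (hf : Measurable f) :
    Measurable fun x => eLpNorm (fun y => f (x, y)) ⊤ ν := by
  refine measurable_of_Iic fun a => ?_
  have h1 : (fun x => eLpNorm (fun y => f (x, y)) ⊤ ν) ⁻¹' Iic a =
      (fun x => ν (Prod.mk x ⁻¹' {z | a < ‖f z‖ₑ})) ⁻¹' {0} := by
    ext x
    simp only [mem_preimage, mem_Iic, mem_singleton_iff, eLpNorm_exponent_top]
    constructor
    · intro h
      refine measure_mono_null (fun y hy => ?_) (ae_le_eLpNormEssSup (f := fun y => f (x, y))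
        (μ := ν))
      exact not_le.2 (h.trans_lt hy)
    · intro h
      refine essSup_le_of_ae_le a ?_
      rw [EventuallyLE, ae_iff]
      simpa using h
  rw [h1]
  exact measurable_measure_prodMk_left (measurableSet_lt measurable_const hf.enorm)
    (measurableSet_singleton 0)

/-- Up to the two endpoint times, `pd` off K is the ordinary derivative, which is measurable for an
arbitrary function. -/
theorem aemeasurable_eLpNorm_pd (hK : IsClosed K) (f : Spacetime → ℝ) (i : Fin 4) :
    AEMeasurable (fun t => eLpNorm (fun x : Space => pd (domain T K) i f (t, x)) ⊤
      (volume.restrict Kᶜ)) (volume.restrict (Icc 0 T)) := by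
  rw [← restrict_Ioo_eq_restrict_Icc]
  refine ⟨_, measurable_eLpNorm_top_slice (ν := volume.restrict Kᶜ)
    (measurable_fderiv_apply_const ℝ f (dir i)), ?_⟩
  filter_upwards [ae_restrict_mem measurableSet_Ioo] with t ht
  refine eLpNorm_congr_ae ?_
  filter_upwards [ae_restrict_mem hK.isOpen_compl.measurableSet] with x hx
  exact pd_eq_fderiv (z := ((t, x) : Spacetime)) hK ⟨ht.2, hx⟩ i

theorem aemeasurable_derivSup (hK : IsClosed K) :
    AEMeasurable (derivSup T K γ) (volume.restrict (Icc 0 T)) := by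
  unfold derivSup
  refine Finset.aemeasurable_fun_sum _ fun I _ => Finset.aemeasurable_fun_sum _ fun J _ =>
    Finset.aemeasurable_fun_sum _ fun i _ => Finset.aemeasurable_fun_sum _ fun j _ =>
    Finset.aemeasurable_fun_sum _ fun k _ => aemeasurable_eLpNorm_pd hK _ _

theorem lintegral_derivSup (hK : IsClosed K) :
    ∫⁻ t in Icc 0 T, derivSup T K γ t = derivNorm T K γ := by
  have hm := fun I J i j k => aemeasurable_eLpNorm_pd (T := T) hK (γ I J j k) i
  unfold derivSup derivNorm
  rw [lintegral_finsetSum' _ fun I _ => Finset.aemeasurable_fun_sum _ fun J _ =>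
    Finset.aemeasurable_fun_sum _ fun i _ => Finset.aemeasurable_fun_sum _ fun j _ =>
    Finset.aemeasurable_fun_sum _ fun k _ => hm I J i j k]
  refine Finset.sum_congr rfl fun I _ => ?_
  rw [lintegral_finsetSum' _ fun J _ =>
    Finset.aemeasurable_fun_sum _ fun i _ => Finset.aemeasurable_fun_sum _ fun j _ =>
    Finset.aemeasurable_fun_sum _ fun k _ => hm I J i j k]
  refine Finset.sum_congr rfl fun J _ => ?_
  rw [lintegral_finsetSum' _ fun i _ => Finset.aemeasurable_fun_sum _ fun j _ =>
    Finset.aemeasurable_fun_sum _ fun k _ => hm I J i j k]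
  refine Finset.sum_congr rfl fun i _ => ?_
  rw [lintegral_finsetSum' _ fun j _ => Finset.aemeasurable_fun_sum _ fun k _ => hm I J i j k]
  refine Finset.sum_congr rfl fun j _ => ?_
  rw [lintegral_finsetSum' _ fun k _ => hm I J i j k]

theorem ae_derivSum_le (t : ℝ) :
    ∀ᵐ x ∂volume.restrict Kᶜ, ENNReal.ofReal (derivSum T K γ (t, x)) ≤ derivSup T K γ t := by
  have h1 : ∀ᵐ x ∂volume.restrict Kᶜ, ∀ I J i j k, ‖pd (domain T K) i (γ I J j k) (t, x)‖ₑ ≤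
      eLpNorm (fun x : Space => pd (domain T K) i (γ I J j k) (t, x)) ⊤ (volume.restrict Kᶜ) := by
    simp only [ae_all_iff, eLpNorm_exponent_top]
    intro I J i j k
    exact ae_le_eLpNormEssSup
  filter_upwards [h1] with x hx
  have h2 : ENNReal.ofReal (derivSum T K γ (t, x)) =
      ∑ i, ∑ α : Fin N × Fin 4, ∑ β : Fin N × Fin 4,
        ‖pd (domain T K) i (γ α.1 β.1 α.2 β.2) (t, x)‖ₑ := by
    rw [derivSum, ENNReal.ofReal_sum_of_nonneg fun _ _ => Finset.sum_nonneg fun _ _ =>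
      Finset.sum_nonneg fun _ _ => abs_nonneg _]
    refine Finset.sum_congr rfl fun i _ => ?_
    rw [ENNReal.ofReal_sum_of_nonneg fun _ _ => Finset.sum_nonneg fun _ _ => abs_nonneg _]
    refine Finset.sum_congr rfl fun α _ => ?_
    rw [ENNReal.ofReal_sum_of_nonneg fun _ _ => abs_nonneg _]
    exact Finset.sum_congr rfl fun β _ => (Real.enorm_eq_ofReal_abs _).symm
  rw [h2]
  calc _ ≤ ∑ i, ∑ α : Fin N × Fin 4, ∑ β : Fin N × Fin 4, eLpNorm (fun x : Space =>
        pd (domain T K) i (γ α.1 β.1 α.2 β.2) (t, x)) ⊤ (volume.restrict Kᶜ) :=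
        Finset.sum_le_sum fun i _ => Finset.sum_le_sum fun α _ => Finset.sum_le_sum fun β _ =>
          hx _ _ _ _ _
    _ = derivSup T K γ t := by
        simp only [Fintype.sum_prod_type, derivSup]
        rw [Finset.sum_comm]
        refine Finset.sum_congr rfl fun I _ => ?_
        have h3 : ∀ f : Fin 4 → Fin N → Fin 4 → ℝ≥0∞,
            ∑ j, ∑ J, ∑ k, f j J k = ∑ J, ∑ j, ∑ k, f j J k := fun _ => Finset.sum_comm
        simp only [h3]

theorem eLpNorm_toLp_two_eq {X ι : Type*} [MeasurableSpace X] [Fintype ι] {μ : Measure X}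
    (f : X → ι → ℝ) :
    eLpNorm (fun x => WithLp.toLp 2 (f x)) 2 μ =
      (∫⁻ x, ENNReal.ofReal (∑ i, f x i ^ 2) ∂μ) ^ (1 / 2 : ℝ) := by
  rw [eLpNorm_eq_lintegral_rpow_enorm_toReal (by norm_num) (by norm_num)]
  simp only [ENNReal.toReal_ofNat]
  congr 1
  refine lintegral_congr fun x => ?_
  rw [← ofReal_norm, ENNReal.ofReal_rpow_of_nonneg (norm_nonneg _) (by norm_num)]
  congr 1
  rw [Real.rpow_two, EuclideanSpace.norm_sq_eq]
  simp

theorem sliceNorm_eq (s : ℝ) : sliceNorm K F s =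
    (∫⁻ x in Kᶜ, ENNReal.ofReal (∑ I, F I (s, x) ^ 2)) ^ (1 / 2 : ℝ) :=
  eLpNorm_toLp_two_eq _

theorem gradNorm_eq (t : ℝ) : gradNorm T K w t =
    (∫⁻ x in Kᶜ, ENNReal.ofReal (gradSq T K w (t, x))) ^ (1 / 2 : ℝ) :=
  eLpNorm_toLp_two_eq _

theorem abs_work_le (z : Spacetime) :
    |work T K w F z| ≤ √(gradSq T K w z) * √(∑ I, F I z ^ 2) := by
  rw [← Real.sqrt_mul (gradSq_nonneg z)]
  refine Real.abs_le_sqrt ?_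
  refine (Finset.sum_mul_sq_le_sq_mul_sq _ _ _).trans ?_
  refine mul_le_mul_of_nonneg_right ?_ (Finset.sum_nonneg fun _ _ => sq_nonneg _)
  rw [gradSq, sqLen, Fintype.sum_prod_type]
  exact Finset.sum_le_sum fun I _ => Finset.single_le_sum (f := fun j => grad T K w (I, j) z ^ 2)
    (fun _ _ => sq_nonneg _) (Finset.mem_univ 0)

/-! ### Growth of the localized energy, Gronwall, and the limit R → ∞. -/

namespace IsCoercive

/-- The equation expresses F through continuous functions; this supplies all the measurability of F
that is needed. -/
theorem continuousOn_force (h : IsCoercive T K c γ w F lam Γ) (I : Fin N) :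
    ContinuousOn (F I) (Ioo 0 T ×ˢ Kᶜ) := by
  have hopen : IsOpen (Ioo 0 T ×ˢ Kᶜ) := isOpen_Ioo.prod h.isClosed.isOpen_compl
  have hpp : ∀ J j k, ContinuousOn (pd (domain T K) j (pd (domain T K) k (w J)))
      (Ioo 0 T ×ˢ Kᶜ) := by
    intro J j k
    have h1 : ContDiffOn ℝ 1 (pd (domain T K) k (w J)) (Ioo 0 T ×ˢ Kᶜ) :=
      (contDiffOn_pd h.isClosed (h.solution.contDiffOn J) k).mono
        (prod_mono (fun t ht => ht.2.le) le_rfl)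
    refine ((h1.continuousOn_fderiv_of_isOpen hopen le_rfl).clm_apply
      (continuousOn_const (c := dir j))).congr fun z hz => ?_
    exact pd_eq_fderiv h.isClosed ⟨hz.1.2, hz.2⟩ j
  have hγ : ∀ J j k, ContinuousOn (γ I J j k) (Ioo 0 T ×ˢ Kᶜ) := fun J j k =>
    (h.lipschitz I J j k).continuousOn.mono (prod_mono Ioo_subset_Icc_self le_rfl)
  have hbox : ContinuousOn (perturbedBox (domain T K) c γ w I) (Ioo 0 T ×ˢ Kᶜ) := by
    refine ContinuousOn.add (ContinuousOn.sub (hpp _ _ _) (continuousOn_const.mul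
      (continuousOn_finsetSum _ fun k _ => hpp _ _ _))) ?_
    exact continuousOn_finsetSum _ fun J _ => continuousOn_finsetSum _ fun j _ =>
      continuousOn_finsetSum _ fun k _ => (hγ J j k).mul (hpp _ _ _)
  exact hbox.congr fun z hz => (h.solution.equation I z.1 hz.1 z.2 hz.2).symm

theorem aemeasurable_sliceNorm (h : IsCoercive T K c γ w F lam Γ) :
    AEMeasurable (sliceNorm K F) (volume.restrict (Ioc 0 T)) := by
  rw [← restrict_Ioo_eq_restrict_Ioc]
  have hm : AEMeasurable (fun z : Spacetime => ENNReal.ofReal (∑ I, F I z ^ 2))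
      ((volume.restrict (Ioo 0 T)).prod (volume.restrict Kᶜ)) := by
    rw [Measure.prod_restrict]
    refine (ContinuousOn.aemeasurable ?_ (measurableSet_Ioo.prod
      h.isClosed.isOpen_compl.measurableSet)).ennreal_ofReal
    exact continuousOn_finsetSum _ fun I _ => (h.continuousOn_force I).pow 2
  have := hm.lintegral_prod_right'.pow_const (1 / 2 : ℝ)
  refine this.congr (ae_of_all _ fun s => ?_)
  exact (sliceNorm_eq s).symm

/-- Cauchy–Schwarz in x for the work of the force, and the essential supremum for the derivatives of
the coefficients. -/
theorem growth_le (h : IsCoercive T K c γ w F lam Γ) {M R : ℝ} (hM : 0 < M) (hR : 0 < R) {s : ℝ}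
    (hs : s ∈ Ioo 0 T) :
    growth T K γ w F M R s ≤ energy T K w M R s ^ (1 / 2 : ℝ) * sliceNorm K F s +
      2 * derivSup T K γ s * energy T K w M R s := by
  have hKm : MeasurableSet Kᶜ := h.isClosed.isOpen_compl.measurableSet
  have hs' : s ∈ Icc 0 T := Ioo_subset_Icc_self hs
  have hχ : Continuous fun x : Space => coneCutoff M R (s, x) :=
    continuous_coneCutoff.comp (by fun_prop)
  have hF : ∀ I, ContinuousOn (fun x => F I (s, x)) Kᶜ := fun I =>
    (h.continuousOn_force I).comp (by fun_prop) fun x hx => ⟨hs, hx⟩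
  have hg : ∀ α, ContinuousOn (fun x => grad T K w α (s, x)) Kᶜ := fun α =>
    (h.locallyLipschitzOn_grad α).continuousOn.comp (by fun_prop) fun x hx => ⟨hs', hx⟩
  have hgm := h.measurable_gradSq_slice hs'
  have hFm : AEMeasurable (fun x => ∑ I, F I (s, x) ^ 2) (volume.restrict Kᶜ) :=
    (continuousOn_finsetSum _ fun I _ => (hF I).pow 2).aemeasurable hKm
  have hwm : AEMeasurable (fun x => coneCutoff M R (s, x) * |work T K w F (s, x)|)
      (volume.restrict Kᶜ) :=
    (hχ.continuousOn.mul (continuousOn_finsetSum _ fun I _ =>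
      (hg (I, 0)).mul (hF I)).abs).aemeasurable hKm
  rw [growth, lintegral_add_left' hwm.ennreal_ofReal]
  refine add_le_add ?_ ?_
  · have hcs := ENNReal.lintegral_mul_le_Lp_mul_Lq (volume.restrict Kᶜ)
      Real.HolderConjugate.two_two
      (f := fun x => ENNReal.ofReal (√(coneCutoff M R (s, x) * gradSq T K w (s, x))))
      (g := fun x => ENNReal.ofReal (√(∑ I, F I (s, x) ^ 2)))
      (hχ.aemeasurable.mul hgm).sqrt.ennreal_ofReal hFm.sqrt.ennreal_ofReal
    have hsq : ∀ r : ℝ, 0 ≤ r → ENNReal.ofReal (√r) ^ (2 : ℝ) = ENNReal.ofReal r := by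
      intro r hr
      rw [ENNReal.ofReal_rpow_of_nonneg (Real.sqrt_nonneg _) (by norm_num), Real.rpow_two,
        Real.sq_sqrt hr]
    have hcg : ∀ x, 0 ≤ coneCutoff M R (s, x) * gradSq T K w (s, x) := fun x =>
      mul_nonneg coneCutoff_nonneg (gradSq_nonneg _)
    have hFs : ∀ x, 0 ≤ ∑ I, F I (s, x) ^ 2 := fun x => Finset.sum_nonneg fun _ _ => sq_nonneg _
    simp only [hsq _ (hcg _), hsq _ (hFs _)] at hcs
    rw [← sliceNorm_eq] at hcs
    refine le_trans (lintegral_mono fun x => ?_) hcs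
    simp only [Pi.mul_apply]
    rw [← ENNReal.ofReal_mul (Real.sqrt_nonneg _)]
    refine ENNReal.ofReal_le_ofReal ?_
    have hχ0 : 0 ≤ coneCutoff M R (s, x) := coneCutoff_nonneg
    have hχ1 : coneCutoff M R (s, x) ≤ 1 := coneCutoff_le_one hM.le hR hs.1.le
    rw [Real.sqrt_mul hχ0, mul_assoc]
    -- As 0 ≤ χ ≤ 1, half of the weight goes to the energy factor and F needs none.
    have h1 : coneCutoff M R (s, x) ≤ √(coneCutoff M R (s, x)) := by
      refine Real.le_sqrt_of_sq_le ?_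
      nlinarith
    have h2 := abs_work_le (T := T) (K := K) (w := w) (F := F) (s, x)
    gcongr
  · rw [energy]
    have h1 : ∫⁻ x in Kᶜ, ENNReal.ofReal
        (2 * derivSum T K γ (s, x) * (coneCutoff M R (s, x) * gradSq T K w (s, x))) ≤
        ∫⁻ x in Kᶜ, 2 * derivSup T K γ s *
          ENNReal.ofReal (coneCutoff M R (s, x) * gradSq T K w (s, x)) := by
      refine lintegral_mono_ae ?_
      filter_upwards [ae_derivSum_le (γ := γ) (K := K) (T := T) s] with x hx
      have h2 : 0 ≤ derivSum T K γ (s, x) := derivSum_nonneg _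
      rw [ENNReal.ofReal_mul (by positivity), ENNReal.ofReal_mul zero_le_two, ENNReal.ofReal_ofNat]
      gcongr
    have h2 : AEMeasurable (fun x => ENNReal.ofReal
        (coneCutoff M R (s, x) * gradSq T K w (s, x))) (volume.restrict Kᶜ) :=
      (hχ.aemeasurable.mul hgm).ennreal_ofReal
    rwa [lintegral_const_mul'' _ h2] at h1

/-- A priori finiteness for the Gronwall lemma. The bound depends on R and w, but does not enter the
final constant. -/
theorem exists_energy_le (h : IsCoercive T K c γ w F lam Γ) {M R : ℝ} (hM : 0 < M) (hR : 0 < R) :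
    ∃ Y : ℝ≥0∞, Y ≠ ⊤ ∧ ∀ t ∈ Icc 0 T, energy T K w M R t ≤ Y := by
  obtain ⟨B, hB0, hB⟩ := h.exists_bound_grad R
  have hKm : MeasurableSet Kᶜ := h.isClosed.isOpen_compl.measurableSet
  refine ⟨ENNReal.ofReal (∑ _α : Fin N × Fin 4, B ^ 2) * volume (Metric.closedBall (0 : Space) R),
    ENNReal.mul_ne_top ENNReal.ofReal_ne_top measure_closedBall_lt_top.ne, fun t ht => ?_⟩
  calc energy T K w M R t ≤ ∫⁻ x in Kᶜ, (Metric.closedBall (0 : Space) R).indicator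
        (fun _ => ENNReal.ofReal (∑ _α : Fin N × Fin 4, B ^ 2)) x := by
        refine setLIntegral_mono' hKm fun x hx => ?_
        by_cases hxR : ‖x‖ ≤ R
        · rw [indicator_of_mem (by simpa using hxR)]
          refine ENNReal.ofReal_le_ofReal ?_
          calc coneCutoff M R (t, x) * gradSq T K w (t, x) ≤ 1 * gradSq T K w (t, x) :=
                mul_le_mul_of_nonneg_right (coneCutoff_le_one hM.le hR ht.1) (gradSq_nonneg _)
            _ = gradSq T K w (t, x) := one_mul _
            _ ≤ _ := by
                rw [gradSq, sqLen]
                refine Finset.sum_le_sum fun α _ => ?_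
                rw [← sq_abs]
                exact pow_le_pow_left₀ (abs_nonneg _) ((hB t ht x hx hxR).1 α) 2
        · push Not at hxR
          rw [coneCutoff_eq_zero (z := ((t, x) : Spacetime)) hM.le hR ht.1 hxR.le, zero_mul, ENNReal.ofReal_zero]
          exact zero_le
    _ ≤ ∫⁻ x, (Metric.closedBall (0 : Space) R).indicator
        (fun _ => ENNReal.ofReal (∑ _α : Fin N × Fin 4, B ^ 2)) x := setLIntegral_le_lintegral _ _
    _ = _ := lintegral_indicator_const Metric.isClosed_closedBall.measurableSet _

/-- The energy inequality on a backward cone. -/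
theorem sqrt_energy_le (h : IsCoercive T K c γ w F lam Γ) {M R : ℝ} (hM : 0 < M) (hR : 0 < R)
    (hΓM : 3 * Γ ≤ lam * M) {C₀ : ℝ≥0} (hC₀ : derivNorm T K γ ≤ C₀) {t : ℝ} (ht : t ∈ Icc 0 T) :
    energy T K w M R t ^ (1 / 2 : ℝ) ≤
      ENNReal.ofReal (2 * lam⁻¹ * Real.exp (2 * lam⁻¹ * (2 * C₀))) *
        ∫⁻ s in Ioc 0 t, sliceNorm K F s := by
  obtain ⟨Y, hY, hyY⟩ := h.exists_energy_le hM hR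
  have hsub : Ioc 0 t ⊆ Ioc 0 T := Ioc_subset_Ioc_right ht.2
  have hsub' : Ioc 0 t ⊆ Icc 0 T := hsub.trans Ioc_subset_Icc_self
  have hlam := h.lam_pos
  -- Gronwall is applied with κ = 1/lam, a = 2 `derivSup` and A₀ = 2 C₀; the 2 comes from the bound
  -- on `coeffError`.
  have hκ : (0 : ℝ≥0) < lam⁻¹.toNNReal := Real.toNNReal_pos.2 (by positivity)
  have hκ' : ((lam⁻¹.toNNReal : ℝ≥0) : ℝ) = lam⁻¹ := Real.coe_toNNReal _ (by positivity)
  have hda : AEMeasurable (derivSup T K γ) (volume.restrict (Ioc 0 t)) :=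
    (aemeasurable_derivSup h.isClosed).mono_measure (Measure.restrict_mono hsub' le_rfl)
  have hA : ∫⁻ s in Ioc 0 t, 2 * derivSup T K γ s ≤ ((2 * C₀ : ℝ≥0) : ℝ≥0∞) := by
    rw [lintegral_const_mul'' _ hda]
    push_cast
    gcongr
    refine le_trans (lintegral_mono_set hsub') ?_
    rw [lintegral_derivSup h.isClosed]
    exact hC₀
  have hmain := sqrt_le_of_le_lintegral (t₀ := t) ht.1 (a := fun s => 2 * derivSup T K γ s)
    (f := sliceNorm K F) (y := energy T K w M R) (κ := lam⁻¹.toNNReal) (A₀ := 2 * C₀) hκ hY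
    (hda.const_mul 2)
    (h.aemeasurable_sliceNorm.mono_measure (Measure.restrict_mono hsub le_rfl)) hA
    (fun s hs => hyY s ⟨hs.1, hs.2.trans ht.2⟩) ?_
  · rw [hκ'] at hmain
    exact_mod_cast hmain
  · intro s hs
    have hsT : s ∈ Icc 0 T := ⟨hs.1, hs.2.trans ht.2⟩
    have h1 := h.energy_le hM hR hΓM hsT
    have h2 : ∫⁻ r in Ioc 0 s, growth T K γ w F M R r ≤
        ∫⁻ r in Ioc 0 s, (energy T K w M R r ^ (1 / 2 : ℝ) * sliceNorm K F r +
          2 * derivSup T K γ r * energy T K w M R r) := by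
      rw [← restrict_Ioo_eq_restrict_Ioc]
      exact setLIntegral_mono' measurableSet_Ioo fun r hr =>
        h.growth_le hM hR ⟨hr.1, hr.2.trans_le hsT.2⟩
    have h3 : ((lam⁻¹.toNNReal : ℝ≥0) : ℝ≥0∞) * ENNReal.ofReal lam = 1 := by
      change ENNReal.ofReal lam⁻¹ * ENNReal.ofReal lam = 1
      rw [← ENNReal.ofReal_mul (by positivity), inv_mul_cancel₀ hlam.ne', ENNReal.ofReal_one]
    calc energy T K w M R s = ((lam⁻¹.toNNReal : ℝ≥0) : ℝ≥0∞) *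
          (ENNReal.ofReal lam * energy T K w M R s) := by rw [← mul_assoc, h3, one_mul]
      _ ≤ _ := by
          gcongr
          exact h1.trans h2

/-- The constant in `sqrt_energy_le` is independent of M and R, so R = n + 1 → ∞ and monotone
convergence remove the cone cutoff. -/
theorem gradNorm_le (h : IsCoercive T K c γ w F lam Γ) {C₀ : ℝ≥0} (hC₀ : derivNorm T K γ ≤ C₀)
    {t : ℝ} (ht : t ∈ Icc 0 T) :
    gradNorm T K w t ≤ ENNReal.ofReal (2 * lam⁻¹ * Real.exp (2 * lam⁻¹ * (2 * C₀))) *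
      ∫⁻ s in Ioc 0 t, sliceNorm K F s := by
  have hlam := h.lam_pos
  have hΓ := h.Γ_nonneg
  -- Any speed with 3Γ ≤ lam M would do; the added 1 keeps M positive when Γ = 0.
  set M : ℝ := (3 * Γ + 1) / lam with hMdef
  have hM : 0 < M := by positivity
  have hΓM : 3 * Γ ≤ lam * M := by
    rw [hMdef, mul_div_cancel₀ _ hlam.ne']
    linarith
  have hχ : ∀ n : ℕ, Continuous fun x : Space => coneCutoff M (n + 1) (t, x) := fun n =>
    continuous_coneCutoff.comp (by fun_prop)
  have h1 : Tendsto (fun n : ℕ => energy T K w M (n + 1) t) atTop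
      (𝓝 (∫⁻ x in Kᶜ, ENNReal.ofReal (gradSq T K w (t, x)))) := by
    refine lintegral_tendsto_of_tendsto_of_monotone ?_ ?_ ?_
    · intro n
      exact ((hχ n).aemeasurable.mul (h.measurable_gradSq_slice ht)).ennreal_ofReal
    · refine ae_of_all _ fun x => ?_
      intro m n hmn
      refine ENNReal.ofReal_le_ofReal ?_
      exact mul_le_mul_of_nonneg_right
        (coneCutoff_mono (z := ((t, x) : Spacetime)) hM.le ht.1 hmn) (gradSq_nonneg _)
    · refine ae_of_all _ fun x => ENNReal.tendsto_ofReal ?_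
      have := (tendsto_coneCutoff (M := M) (z := ((t, x) : Spacetime))).mul_const
        (gradSq T K w (t, x))
      simpa using this
  have h2 := (ENNReal.continuous_rpow_const (y := (1 / 2 : ℝ))).continuousAt.tendsto.comp h1
  rw [gradNorm_eq]
  exact le_of_tendsto' h2 fun n => h.sqrt_energy_le hM (by positivity) hΓM hC₀ ht

end IsCoercive

/-! ### Choice of the constants and conclusion. -/

theorem exists_pos_le_sq (c : Fin N → ℝ) (hc : ∀ I, 0 < c I) :
    ∃ lam : ℝ, 0 < lam ∧ lam ≤ 1 ∧ ∀ I, lam ≤ c I ^ 2 := by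
  rcases isEmpty_or_nonempty (Fin N) with hN | hN
  · exact ⟨1, one_pos, le_rfl, fun I => hN.elim I⟩
  · obtain ⟨I₀, hI₀⟩ := Finite.exists_min c
    refine ⟨min 1 (c I₀ ^ 2), lt_min one_pos (pow_pos (hc I₀) 2), min_le_left _ _, fun I => ?_⟩
    exact (min_le_right _ _).trans (pow_le_pow_left₀ (hc I₀).le (hI₀ I) 2)

end Energy

end DirichletWave

end

theorem theorem5p1 (N : ℕ) (c : Fin N → ℝ) (hc : ∀ I, 0 < c I) :
    ∃ δ : ℝ≥0, 0 < δ ∧ ∀ C₀ : ℝ≥0, ∃ C : ℝ≥0,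
      ∀ (K : Set DirichletWave.Space), DirichletWave.IsStarShapedObstacle K →
      ∀ (T : ℝ), 0 < T →
      ∀ (γ : Fin N → Fin N → Fin 4 → Fin 4 → DirichletWave.Spacetime → ℝ),
        (∀ I J j k, LocallyLipschitzOn (Icc 0 T ×ˢ Kᶜ) (γ I J j k)) →
        DirichletWave.IsSymmetric T K γ →
        DirichletWave.supNorm T K γ ≤ δ →
        DirichletWave.derivNorm T K γ ≤ C₀ →
      ∀ (w F : Fin N → DirichletWave.Spacetime → ℝ),
        DirichletWave.IsDirichletSolution T K c γ w F →
      ∀ t ∈ Icc 0 T,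
        DirichletWave.gradNorm T K w t ≤
          C * ∫⁻ s in Ioc 0 t, DirichletWave.sliceNorm K F s := by
  obtain ⟨lam, hlam, hlam1, hlamc⟩ := DirichletWave.exists_pos_le_sq c hc
  have hδ : (((lam / 6).toNNReal : ℝ≥0) : ℝ) = lam / 6 := Real.coe_toNNReal _ (by positivity)
  -- δ = lam/6 leaves coercivity lam/4, and C is the constant of `gradNorm_le` for that value. It
  -- involves only the wave speeds, through lam, and C₀.
  refine ⟨(lam / 6).toNNReal, Real.toNNReal_pos.2 (by positivity), fun C₀ =>
    ⟨(2 * (lam / 4)⁻¹ * Real.exp (2 * (lam / 4)⁻¹ * (2 * C₀))).toNNReal, ?_⟩⟩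
  intro K hK T hT γ hγ hsymm hsup hder w F hw t ht
  have hbound : ∀ z ∈ Icc 0 T ×ˢ Kᶜ, ∑ α : Fin N × Fin 4, ∑ β : Fin N × Fin 4,
      |γ α.1 β.1 α.2 β.2 z| ≤ lam / 6 := fun z hz => by
    rw [← hδ]
    exact DirichletWave.sum_abs_le_of_supNorm_le hT hK.isClosed hγ hsup hz
  have h : DirichletWave.IsCoercive T K c γ w F (lam / 4)
      ((∑ α, ∑ β, |DirichletWave.boxCoeff c α β|) + lam / 6) :=
    { pos := hT
      isClosed := hK.isClosed
      nonempty := hK.nonempty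
      lipschitz := hγ
      symmetric := hsymm
      solution := hw
      lam_pos := by positivity
      Γ_nonneg := by positivity
      coercive := fun z hz u => DirichletWave.le_flux_zero hlam1 hlamc le_rfl (hbound z hz) u
      bounded := fun z hz => DirichletWave.sum_abs_boxCoeff_add_le (hbound z hz) }
  exact h.gradNorm_le hder ht
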